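/- Let $F$ be a brane tiling of the compact connected oriented surface $M_g$ of genus $g\ge 0$: a tiling of $M_g$ by polygons whose 1-skeleton $\Gamma$ is a bipartite graph with vertices coloured black and white. Let $E$ be the set of edges of $\Gamma$, let $Q$ be the dual quiver (its vertices are the tiles, its arrows the edges in $E$, directed clockwise around the black vertices), let $W$ be the sum of the cycles of $Q$ around the black vertices minus the sum of the cycles around the white vertices, and let $A_F=\mathbb{C}Q/\langle \partial W/\partial X_a : a\in E\rangle$. Fix a tile $i$. Let $\omega_i\in A_F$ be the class of a simple $i$-loop, i.e. of the path starting at $i$ that revolves once around a vertex of the tile $i$ (all these paths have the same class). For $\mathbf{v}\in\mathbb{N}^{V(Q)}$ let $\mathcal{M}_{\mathbf{v},i}$ be the moduli space of pairs $(M,f)$ with $M$ a right $A_F$-module of dimension vector $\mathbf{v}$ and $f:e_iA_F\to M$ a surjection of $A_F$-modules. Let $T'\subset(\mathbb{C}^*)^{E}$ be the group of rescalings of the arrows that preserve the ideal of superpotential relations $\langle\partial W/\partial X_a\rangle$. It acts on $A_F$, and hence on the moduli spaces, which gives a homomorphism $$\theta: T'\to\prod_{\mathbf{v}\in\mathbb{N}^{V(Q)}}\mathrm{Aut}(\mathcal{M}_{\mathbf{v},i}).$$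 Let $T'_W$ be the largest subtorus of $T'$ acting with trivial weight on $\omega_i$, and let $T_W=\theta(T'_W)$, an algebraic group as a quotient of $T'_W$. Then $T_W$ is a torus of dimension $2g$. Moreover, its cocharacter lattice is isomorphic to the dual $H_1(M_g,\mathbb{Z})'=\mathrm{Hom}(H_1(M_g,\mathbb{Z}),\mathbb{Z})\cong\mathbb{Z}^{2g}$ by an isomorphism that sends a cocharacter $\alpha:\mathbb{C}^*\to T_W$ to the functional whose value on the homology class of an $i$-loop $u$ (a path of $Q$ from $i$ to $i$) is the weight with which $\alpha$ acts on $u$: if $t\in T'_W$ and $\theta(t)=\alpha(z)$, then $t\cdot[u]=z^{\Phi(\alpha)([u])}[u]$ in $A_F$, where $\Phi(\alpha)$ is the functional corresponding to $\alpha$. -/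

import Mathlib

open CategoryTheory TensorProduct

universe u

noncomputable section

/-! ### Brane tilings -/

/-- A brane tiling of a closed connected oriented surface, with set of edges `E`, encoded by its
rotation system: a tiling of a closed oriented surface by polygons together with a bipartite
structure on its 1-skeleton is the same thing as a pair of permutations of the (finite, non-empty)
set of edges. `black e` is the next edge after `e` going clockwise around the black endpoint of `e`,
`white e` is the next edge after `e` going anticlockwise around the white endpoint of `e`;
the surface is connected iff the two permutations generate a transitive group. -/
structure BraneTiling (E : Type u) [Fintype E] where
  black : Equiv.Perm E
  white : Equiv.Perm E
  nonempty : Nonempty E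
  connected : MulAction.IsPretransitive
    (Subgroup.closure ({black, white} : Set (Equiv.Perm E))) E

namespace BraneTiling

variable {E : Type u} [Fintype E] (F : BraneTiling E)

/-- The black vertices of the bipartite graph: the cycles of `black` (fixed points included). -/
abbrev BlackVertex : Type u := Quotient (Equiv.Perm.SameCycle.setoid F.black)

/-- The white vertices of the bipartite graph: the cycles of `white` (fixed points included). -/
abbrev WhiteVertex : Type u := Quotient (Equiv.Perm.SameCycle.setoid F.white)

/-- The tiles. Every edge `e`, viewed as an arrow of the dual quiver (clockwise around the black
vertices), leaves exactly one tile, and the arrow leaving the same tile that comes after `e` as one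
walks along the boundary of this tile is `white (black⁻¹ e)`. -/
abbrev Tile : Type u := Quotient (Equiv.Perm.SameCycle.setoid (F.white * F.black⁻¹))

instance : Finite F.BlackVertex := Quotient.finite _
instance : Finite F.WhiteVertex := Quotient.finite _
instance : Finite F.Tile := Quotient.finite _
instance : Fintype F.BlackVertex := Fintype.ofFinite _
instance : Fintype F.WhiteVertex := Fintype.ofFinite _
instance : Fintype F.Tile := Fintype.ofFinite _

/-- The black vertex of an edge. -/
def blackEnd (e : E) : F.BlackVertex := Quotient.mk _ e

/-- The white vertex of an edge. -/
def whiteEnd (e : E) : F.WhiteVertex := Quotient.mk _ e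

/-- The tile `t(a)` at which the arrow `a` of the dual quiver starts. -/
def tail (a : E) : F.Tile := Quotient.mk _ a

/-- The tile `h(a)` at which the arrow `a` of the dual quiver ends; the next arrow clockwise around
the black vertex starts there. -/
def head (a : E) : F.Tile := F.tail (F.black a)

/-- The next arrow anticlockwise around the white vertex starts at `h(a)` as well. -/
theorem head_eq_tail_white (a : E) : F.head a = F.tail (F.white a) := by
  refine Quotient.sound ?_
  exact ⟨1, by simp⟩

/-- The tiled surface has genus `g`, by Euler's formula `V - E + F = 2 - 2g`. -/
def HasGenus (g : ℕ) : Prop :=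
  (Nat.card F.BlackVertex : ℤ) + Nat.card F.WhiteVertex - Nat.card E + Nat.card F.Tile = 2 - 2 * g

/-! ### Homology of the surface -/

/-- The cellular boundary map on 1-chains of the surface, for the cell structure dual to the tiling:
0-cells are the tiles, 1-cells the arrows of the dual quiver, 2-cells the vertices of the
bipartite graph. -/
def d₁ : (E →₀ ℤ) →ₗ[ℤ] (F.Tile →₀ ℤ) :=
  Finsupp.linearCombination ℤ
    fun a => Finsupp.single (F.head a) 1 - Finsupp.single (F.tail a) 1

open Classical in
/-- The cellular boundary map on 2-chains. All 2-cells are oriented clockwise, so the arrows on the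
boundary of the 2-cell of a black vertex are traversed forwards, and the arrows
on the boundary of the 2-cell of a white vertex are traversed backwards. -/
def d₂ : (F.BlackVertex ⊕ F.WhiteVertex →₀ ℤ) →ₗ[ℤ] (E →₀ ℤ) :=
  Finsupp.linearCombination ℤ <| Sum.elim
    (fun v => ∑ a with F.blackEnd a = v, Finsupp.single a 1)
    (fun v => - ∑ a with F.whiteEnd a = v, Finsupp.single a 1)

theorem d₁_d₂ (x : F.BlackVertex ⊕ F.WhiteVertex →₀ ℤ) : F.d₁ (F.d₂ x) = 0 := by
  classical
  suffices h : F.d₁ ∘ₗ F.d₂ = 0 from LinearMap.congr_fun h x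
  have key : ∀ (p : Equiv.Perm E) (s : Finset E), (∀ a, p a ∈ s ↔ a ∈ s) →
      ∑ a ∈ s, (Finsupp.single (F.tail (p a)) (1 : ℤ) - Finsupp.single (F.tail a) 1) = 0 := by
    intro p s hs
    rw [Finset.sum_sub_distrib, sub_eq_zero]
    exact Finset.sum_bijective p p.bijective (fun a => (hs a).symm) (fun _ _ => rfl)
  ext1 v
  ext1
  rcases v with v | v
  · simp only [LinearMap.comp_apply, Finsupp.lsingle_apply, d₂, Finsupp.linearCombination_single,
      one_smul, Sum.elim_inl, map_sum, d₁, LinearMap.zero_apply]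
    refine key F.black _ fun a => ?_
    have : F.blackEnd (F.black a) = F.blackEnd a := Quotient.sound ⟨-1, by simp⟩
    simp [this]
  · simp only [LinearMap.comp_apply, Finsupp.lsingle_apply, d₂, Finsupp.linearCombination_single,
      one_smul, Sum.elim_inr, map_sum, map_neg, d₁, LinearMap.zero_apply, neg_eq_zero,
      F.head_eq_tail_white]
    refine key F.white _ fun a => ?_
    have : F.whiteEnd (F.white a) = F.whiteEnd a := Quotient.sound ⟨-1, by simp⟩
    simp [this]

/-- The boundary map from 2-chains to 1-cycles. -/
def boundary : (F.BlackVertex ⊕ F.WhiteVertex →₀ ℤ) →ₗ[ℤ] LinearMap.ker F.d₁ :=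
  F.d₂.codRestrict _ F.d₁_d₂

/-- The first homology group `H₁(M_g, ℤ)` of the tiled surface. -/
abbrev H₁ : Type u := LinearMap.ker F.d₁ ⧸ LinearMap.range F.boundary

/-- `l` is a (directed) path in the dual quiver from the tile `i` to the tile `j`. -/
def IsPath : F.Tile → F.Tile → List E → Prop
  | i, j, [] => i = j
  | i, j, a :: l => F.tail a = i ∧ IsPath (F.head a) j l

/-- The 1-chain of a path. -/
def chain (l : List E) : E →₀ ℤ := (l.map fun a => Finsupp.single a 1).sum

theorem d₁_chain {i j : F.Tile} {l : List E} (h : F.IsPath i j l) :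
    F.d₁ (chain l) = Finsupp.single j 1 - Finsupp.single i 1 := by
  induction l generalizing i with
  | nil => obtain rfl : i = j := h; simp [chain]
  | cons a l ih =>
    obtain ⟨rfl, h⟩ := h
    have hc : chain (a :: l) = Finsupp.single a 1 + chain l := by simp [chain]
    rw [hc, map_add, ih h]
    simp [d₁]

/-- The homology class of an `i`-loop, that is, of a path from `i` to `i`. -/
def loopClass {i : F.Tile} {l : List E} (h : F.IsPath i i l) : F.H₁ :=
  Submodule.Quotient.mk ⟨chain l, by rw [LinearMap.mem_ker, F.d₁_chain h, sub_self]⟩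

/-! ### The path algebra, the superpotential and the algebra of the tiling -/

/-- The relations presenting the path algebra of the dual quiver in terms of the idempotents
of the tiles and the arrows. The product `u * v` is the path `u` followed by the path `v`. -/
inductive PathRel : FreeAlgebra ℂ (F.Tile ⊕ E) → FreeAlgebra ℂ (F.Tile ⊕ E) → Prop
  | idem (i : F.Tile) : PathRel
      (FreeAlgebra.ι ℂ (Sum.inl i) * FreeAlgebra.ι ℂ (Sum.inl i)) (FreeAlgebra.ι ℂ (Sum.inl i))
  | orth (i j : F.Tile) (h : i ≠ j) : PathRel
      (FreeAlgebra.ι ℂ (Sum.inl i) * FreeAlgebra.ι ℂ (Sum.inl j)) 0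
  | one : PathRel (∑ i, FreeAlgebra.ι ℂ (Sum.inl i)) 1
  | tail (a : E) : PathRel
      (FreeAlgebra.ι ℂ (Sum.inl (F.tail a)) * FreeAlgebra.ι ℂ (Sum.inr a))
      (FreeAlgebra.ι ℂ (Sum.inr a))
  | head (a : E) : PathRel
      (FreeAlgebra.ι ℂ (Sum.inr a) * FreeAlgebra.ι ℂ (Sum.inl (F.head a)))
      (FreeAlgebra.ι ℂ (Sum.inr a))

/-- The path algebra `ℂQ` of the dual quiver. -/
def PathAlgebra : Type u := RingQuot F.PathRel

instance : Ring F.PathAlgebra := inferInstanceAs (Ring (RingQuot F.PathRel))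
instance : Algebra ℂ F.PathAlgebra := inferInstanceAs (Algebra ℂ (RingQuot F.PathRel))

/-- The quotient map onto the path algebra. -/
def toPathAlgebra : FreeAlgebra ℂ (F.Tile ⊕ E) →ₐ[ℂ] F.PathAlgebra :=
  RingQuot.mkAlgHom ℂ F.PathRel

theorem toPathAlgebra_rel {x y : FreeAlgebra ℂ (F.Tile ⊕ E)} (h : F.PathRel x y) :
    F.toPathAlgebra x = F.toPathAlgebra y :=
  RingQuot.mkAlgHom_rel ℂ h

/-- The universal property of the path algebra. -/
def liftPath {B : Type*} [Semiring B] [Algebra ℂ B] (f : FreeAlgebra ℂ (F.Tile ⊕ E) →ₐ[ℂ] B)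
    (h : ∀ ⦃x y⦄, F.PathRel x y → f x = f y) : F.PathAlgebra →ₐ[ℂ] B :=
  RingQuot.liftAlgHom ℂ ⟨f, h⟩

theorem liftPath_apply {B : Type*} [Semiring B] [Algebra ℂ B]
    (f : FreeAlgebra ℂ (F.Tile ⊕ E) →ₐ[ℂ] B) (h : ∀ ⦃x y⦄, F.PathRel x y → f x = f y)
    (x : FreeAlgebra ℂ (F.Tile ⊕ E)) : F.liftPath f h (F.toPathAlgebra x) = f x :=
  RingQuot.liftAlgHom_mkAlgHom_apply ℂ f h x

/-- The path of length zero at a tile. -/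
def vtx (i : F.Tile) : F.PathAlgebra :=
  F.toPathAlgebra (FreeAlgebra.ι ℂ (Sum.inl i))

/-- The element of the path algebra given by an arrow. -/
def arr (a : E) : F.PathAlgebra :=
  F.toPathAlgebra (FreeAlgebra.ι ℂ (Sum.inr a))

/-- The element of the path algebra given by the path starting at `i` and following the arrows
in `l`. -/
def word (i : F.Tile) (l : List E) : F.PathAlgebra := F.vtx i * (l.map F.arr).prod

/-- `a, p a, p² a, …`, ending just before `a` comes back. -/
def turn (p : Equiv.Perm E) (a : E) : List E := List.iterate p a (Function.minimalPeriod p a)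

/-- The superpotential. The space `ℂQ/[ℂQ,ℂQ]` is spanned by the cyclic words, and `W` is the sum of
the cycles around the black vertices minus the sum of the cycles around the white vertices. -/
def superpotential : Cycle E →₀ ℂ :=
  ∑ v : F.BlackVertex, Finsupp.single (turn F.black v.out : Cycle E) 1 -
    ∑ v : F.WhiteVertex, Finsupp.single (turn F.white v.out : Cycle E) 1

open Classical in
/-- The noncommutative derivation `∂/∂X_a`: cyclically permute each instance of `a` to the front
and delete it. -/
def cyclicDeriv (a : E) : (Cycle E →₀ ℂ) →ₗ[ℂ] F.PathAlgebra :=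
  Finsupp.linearCombination ℂ fun c =>
    ((c.lists.filter fun l => l.head? = some a).map fun l => F.word (F.head a) l.tail).sum

/-- The relations `∂W/∂X_a = 0`. -/
def FTerm (x y : F.PathAlgebra) : Prop := ∃ a, x = F.cyclicDeriv a F.superpotential ∧ y = 0

/-- The algebra `A_F`: the quotient of the path algebra by the two-sided ideal generated by all
`∂W/∂X_a`. -/
def Alg : Type u := RingQuot F.FTerm

instance : Ring F.Alg := inferInstanceAs (Ring (RingQuot F.FTerm))
instance : Algebra ℂ F.Alg := inferInstanceAs (Algebra ℂ (RingQuot F.FTerm))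

/-- The quotient map from the path algebra to `A_F`. -/
def toAlg : F.PathAlgebra →ₐ[ℂ] F.Alg := RingQuot.mkAlgHom ℂ F.FTerm

theorem toAlg_rel (a : E) : F.toAlg (F.cyclicDeriv a F.superpotential) = 0 :=
  (RingQuot.mkAlgHom_rel ℂ (⟨a, rfl, rfl⟩ : F.FTerm _ 0)).trans (map_zero F.toAlg)

/-- The universal property of `A_F`. -/
def liftAlg {B : Type*} [Semiring B] [Algebra ℂ B] (f : F.PathAlgebra →ₐ[ℂ] B)
    (h : ∀ a, f (F.cyclicDeriv a F.superpotential) = 0) : F.Alg →ₐ[ℂ] B :=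
  RingQuot.liftAlgHom ℂ ⟨f, by rintro x y ⟨a, rfl, rfl⟩; rw [h, map_zero]⟩

theorem liftAlg_apply {B : Type*} [Semiring B] [Algebra ℂ B] (f : F.PathAlgebra →ₐ[ℂ] B)
    (h : ∀ a, f (F.cyclicDeriv a F.superpotential) = 0) (x : F.PathAlgebra) :
    F.liftAlg f h (F.toAlg x) = f x :=
  RingQuot.liftAlgHom_mkAlgHom_apply ℂ f _ x

/-- The idempotent `e_i`. -/
def idem (i : F.Tile) : F.Alg := F.toAlg (F.vtx i)

/-- The class `[u]` in `A_F` of the path `u` starting at `i` and following the arrows in `l`. -/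
def cls (i : F.Tile) (l : List E) : F.Alg := F.toAlg (F.word i l)

/-- `l` is a simple `i`-loop: one revolution around one of the vertices of the tile `i`. All of
these loops have the same class `ω_i` in `A_F`. -/
def IsSimpleLoop (i : F.Tile) (l : List E) : Prop :=
  ∃ a, F.tail a = i ∧ (l = turn F.black a ∨ l = turn F.white a)

/-! ### Rescaling the edges -/

/-- The endomorphism of the path algebra that rescales each arrow `a` by `t a`. -/
def rescale (t : E → ℂˣ) : F.PathAlgebra →ₐ[ℂ] F.PathAlgebra :=
  F.liftPath (FreeAlgebra.lift ℂ (Sum.elim F.vtx fun a => (t a : ℂ) • F.arr a)) <| by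
    intro x y h
    have hr := F.toPathAlgebra_rel h
    cases h <;> simp only [map_mul, map_sum, map_one, map_zero, FreeAlgebra.lift_ι_apply,
      Sum.elim_inl, Sum.elim_inr, mul_smul_comm, smul_mul_assoc] at hr ⊢ <;>
      first
        | exact hr
        | exact congrArg _ hr

theorem rescale_vtx (t : E → ℂˣ) (i : F.Tile) : F.rescale t (F.vtx i) = F.vtx i :=
  (F.liftPath_apply _ _ _).trans (by rw [FreeAlgebra.lift_ι_apply]; rfl)

theorem rescale_arr (t : E → ℂˣ) (a : E) : F.rescale t (F.arr a) = (t a : ℂ) • F.arr a :=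
  (F.liftPath_apply _ _ _).trans (by rw [FreeAlgebra.lift_ι_apply]; rfl)

theorem pathAlgebra_hom_ext {B : Type*} [Semiring B] [Algebra ℂ B] {f g : F.PathAlgebra →ₐ[ℂ] B}
    (hv : ∀ i, f (F.vtx i) = g (F.vtx i)) (ha : ∀ a, f (F.arr a) = g (F.arr a)) : f = g := by
  apply RingQuot.ringQuot_ext'
  apply FreeAlgebra.hom_ext
  funext x
  rcases x with i | a
  · exact hv i
  · exact ha a

theorem rescale_one : F.rescale 1 = AlgHom.id ℂ _ :=
  F.pathAlgebra_hom_ext (by simp [rescale_vtx]) (by simp [rescale_arr])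

theorem rescale_mul (s t : E → ℂˣ) : F.rescale (s * t) = (F.rescale s).comp (F.rescale t) :=
  F.pathAlgebra_hom_ext (by simp [rescale_vtx])
    (by intro a; simp [rescale_arr, smul_smul, mul_comm])

/-- `T'`: the group of those edge rescalings that preserve the superpotential relations, i.e. that
map the ideal of relations in the path algebra onto itself. -/
def relationTorus : Subgroup (E → ℂˣ) where
  carrier := {t | ∀ x, F.toAlg (F.rescale t x) = 0 ↔ F.toAlg x = 0}
  one_mem' x := by rw [F.rescale_one]; rfl
  mul_mem' {s t} hs ht x := by rw [F.rescale_mul]; exact (hs _).trans (ht x)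
  inv_mem' {t} ht x := by
    have h := ht (F.rescale t⁻¹ x)
    have e : F.rescale t (F.rescale t⁻¹ x) = x := by
      rw [← AlgHom.comp_apply, ← F.rescale_mul, mul_inv_cancel, F.rescale_one]; rfl
    rw [e] at h
    exact h.symm

/-- The endomorphism of `A_F` induced by an element of `T'`. -/
def actHom (t : F.relationTorus) : F.Alg →ₐ[ℂ] F.Alg :=
  F.liftAlg (F.toAlg.comp (F.rescale t)) fun a => (t.2 _).2 (F.toAlg_rel a)

theorem actHom_toAlg (t : F.relationTorus) (x : F.PathAlgebra) :
    F.actHom t (F.toAlg x) = F.toAlg (F.rescale t x) :=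
  F.liftAlg_apply _ _ x

theorem alg_hom_ext {B : Type*} [Semiring B] [Algebra ℂ B] {f g : F.Alg →ₐ[ℂ] B}
    (h : ∀ x, f (F.toAlg x) = g (F.toAlg x)) : f = g := by
  apply RingQuot.ringQuot_ext'
  exact AlgHom.ext h

theorem actHom_one : F.actHom 1 = AlgHom.id ℂ _ :=
  F.alg_hom_ext fun x => by rw [actHom_toAlg, OneMemClass.coe_one, rescale_one]; rfl

theorem actHom_mul (s t : F.relationTorus) :
    F.actHom (s * t) = (F.actHom s).comp (F.actHom t) :=
  F.alg_hom_ext fun x => by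
    rw [actHom_toAlg, AlgHom.comp_apply, actHom_toAlg, actHom_toAlg, Subgroup.coe_mul, rescale_mul]
    rfl

/-- The action of `T'` on `A_F` by algebra automorphisms. -/
def act : F.relationTorus →* (F.Alg ≃ₐ[ℂ] F.Alg) where
  toFun t := AlgEquiv.ofAlgHom (F.actHom t) (F.actHom t⁻¹)
    (by rw [← actHom_mul, mul_inv_cancel, actHom_one])
    (by rw [← actHom_mul, inv_mul_cancel, actHom_one])
  map_one' := AlgEquiv.ext fun x => by simp [actHom_one]
  map_mul' s t := AlgEquiv.ext fun x => by simp [actHom_mul]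

theorem act_idem (t : F.relationTorus) (i : F.Tile) : F.act t (F.idem i) = F.idem i := by
  change F.actHom t (F.toAlg _) = _
  rw [actHom_toAlg, rescale_vtx]; rfl

/-! ### The moduli spaces -/

/-- The subspace `e_i A_F e_j` spanned by the paths from `i` to `j`. -/
def corner (i j : F.Tile) : Submodule ℂ F.Alg where
  carrier := {x | F.idem i * x = x ∧ x * F.idem j = x}
  add_mem' hx hy := ⟨by rw [mul_add, hx.1, hy.1], by rw [add_mul, hx.2, hy.2]⟩
  zero_mem' := ⟨mul_zero _, zero_mul _⟩
  smul_mem' c x hx := ⟨by rw [mul_smul_comm, hx.1], by rw [smul_mul_assoc, hx.2]⟩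

/-- Right multiplication `e_i A_F e_j → e_i A_F e_k` by an element of `e_j A_F e_k`. -/
def rmul (i : F.Tile) {j k : F.Tile} (a : F.corner j k) : F.corner i j →ₗ[ℂ] F.corner i k :=
  (LinearMap.mulRight ℂ (a : F.Alg)).restrict fun x hx =>
    ⟨by rw [LinearMap.mulRight_apply, ← mul_assoc, hx.1],
      by rw [LinearMap.mulRight_apply, mul_assoc, a.2.2]⟩

theorem act_mem_corner (t : F.relationTorus) {i j : F.Tile} {x : F.Alg} (hx : x ∈ F.corner i j) :
    F.act t x ∈ F.corner i j := by
  constructor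
  · have := congrArg (F.act t) hx.1
    rwa [map_mul, act_idem] at this
  · have := congrArg (F.act t) hx.2
    rwa [map_mul, act_idem] at this

/-- The action of `T'` on `e_i A_F e_j`. -/
def actCorner (t : F.relationTorus) (i j : F.Tile) : F.corner i j ≃ₗ[ℂ] F.corner i j :=
  LinearEquiv.ofLinearMap
    ((F.act t).toLinearMap.restrict fun _ hx => F.act_mem_corner t hx)
    ((F.act t⁻¹).toLinearMap.restrict fun _ hx => F.act_mem_corner t⁻¹ hx)
    (by
      ext x
      change F.act t (F.act t⁻¹ x) = x
      rw [← AlgEquiv.mul_apply, ← map_mul, mul_inv_cancel, map_one, AlgEquiv.one_apply])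
    (by
      ext x
      change F.act t⁻¹ (F.act t x) = x
      rw [← AlgEquiv.mul_apply, ← map_mul, inv_mul_cancel, map_one, AlgEquiv.one_apply])

theorem actCorner_one (i j : F.Tile) : F.actCorner 1 i j = LinearEquiv.refl ℂ _ := by
  ext x
  change F.act 1 (x : F.Alg) = x
  rw [map_one, AlgEquiv.one_apply]

theorem actCorner_mul (s t : F.relationTorus) (i j : F.Tile) :
    F.actCorner (s * t) i j = (F.actCorner t i j).trans (F.actCorner s i j) := by
  ext x
  change F.act (s * t) (x : F.Alg) = F.act s (F.act t x)
  rw [map_mul, AlgEquiv.mul_apply]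

theorem actCorner_symm (t : F.relationTorus) (i j : F.Tile) :
    (F.actCorner t i j).symm = F.actCorner t⁻¹ i j := by
  ext x
  rfl

/-- The `R`-points of the Grassmannian of rank `k` quotients of the vector space `M`: submodules of
`R ⊗ M` whose quotient is a finitely generated projective `R`-module of constant rank `k`. -/
abbrev Gr (R : Type) [CommRing R] [Algebra ℂ R] (M : Type u) [AddCommGroup M] [Module ℂ M] (k : ℕ) :
    Type u := Module.Grassmannian R (R ⊗[ℂ] M) k

/-- A point, with values in a commutative `ℂ`-algebra `R`, of the moduli space of pairs `(M, f)`
with `M` an `i`-cyclic right module of dimension vector `v` and `f : e_i A_F → M` surjective: up to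
isomorphism such a pair is a right submodule `N = ⨁ j, N e_j` (the kernel of `f`)
of `R ⊗ e_i A_F = ⨁ j, R ⊗ e_i A_F e_j` such that each summand `M e_j = (R ⊗ e_i A_F e_j) / N e_j`
of the quotient is a finitely generated projective `R`-module of constant rank `v j`. -/
@[ext] structure FramedPoint (v : F.Tile → ℕ) (i : F.Tile)
    (R : Type) [CommRing R] [Algebra ℂ R] where
  ker : ∀ j, Gr R (F.corner i j) (v j)
  rmul_mem : ∀ (j k : F.Tile) (a : F.corner j k) (x : R ⊗[ℂ] F.corner i j),
    x ∈ (ker j).toSubmodule → (F.rmul i a).baseChange R x ∈ (ker k).toSubmodule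

section BaseChange

variable {M M' : Type u} [AddCommGroup M] [Module ℂ M] [AddCommGroup M'] [Module ℂ M'] {k k' : ℕ}
  {R S : Type} [CommRing R] [Algebra ℂ R] [CommRing S] [Algebra ℂ S]

theorem mem_map_of_forall (f : R →ₐ[ℂ] S) (N : Gr R M k)
    (N' : Gr R M' k') (h : M →ₗ[ℂ] M')
    (hN : ∀ x ∈ N.toSubmodule, h.baseChange R x ∈ N'.toSubmodule) (x : S ⊗[ℂ] M)
    (hx : x ∈ (N.map f).toSubmodule) : h.baseChange S x ∈ (N'.map f).toSubmodule := by
  rw [Module.Grassmannian.map_toSubmodule] at hx ⊢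
  let _ : Algebra R S := f.toAlgebra
  let _ : IsScalarTower ℂ R S :=
    IsScalarTower.of_algebraMap_eq' <| IsScalarTower.algebraMap_eq ℂ R S
  let q : (R ⊗[ℂ] M) ⧸ N.toSubmodule →ₗ[R] (R ⊗[ℂ] M') ⧸ N'.toSubmodule :=
    Submodule.mapQ _ _ (h.baseChange R) hN
  have key : Module.Grassmannian.baseChangeMkQ S N'.toSubmodule ∘ₗ h.baseChange S =
      q.baseChange S ∘ₗ Module.Grassmannian.baseChangeMkQ S N.toSubmodule := by
    ext m
    simp [Module.Grassmannian.baseChangeMkQ, q]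
  have := LinearMap.congr_fun key x
  rw [LinearMap.comp_apply, LinearMap.comp_apply, LinearMap.mem_ker.1 hx, map_zero] at this
  exact this

/-- The image of a point of a Grassmannian under a linear automorphism. -/
def grassmannianImage (e : M ≃ₗ[ℂ] M') (N : Gr R M k) :
    Gr R M' k :=
  letI q : ((R ⊗[ℂ] M) ⧸ N.toSubmodule) ≃ₗ[R]
      ((R ⊗[ℂ] M') ⧸ N.toSubmodule.map (e.baseChange ℂ R M M').toLinearMap) :=
    Submodule.Quotient.equiv _ _ (e.baseChange ℂ R M M') rfl
  { toSubmodule := N.toSubmodule.map (e.baseChange ℂ R M M').toLinearMap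
    finite_quotient := Module.Finite.equiv q
    projective_quotient := Module.Projective.of_equiv q
    rankAtStalk_eq := fun p => by
      rw [← Module.rankAtStalk_eq_of_equiv q]; exact N.rankAtStalk_eq p }

theorem mem_grassmannianImage (e : M ≃ₗ[ℂ] M') (N : Gr R M k) (x : R ⊗[ℂ] M') :
    x ∈ (grassmannianImage e N).toSubmodule ↔ e.symm.baseChange ℂ R M' M x ∈ N.toSubmodule :=
  Submodule.mem_map_equiv (e := e.baseChange ℂ R M M') N.toSubmodule

theorem map_grassmannianImage (f : R →ₐ[ℂ] S) (e : M ≃ₗ[ℂ] M') (N : Gr R M k) :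
    (grassmannianImage e N).map f = grassmannianImage e (N.map f) := by
  apply Module.Grassmannian.ext
  ext x
  rw [mem_grassmannianImage]
  constructor
  · exact mem_map_of_forall f (grassmannianImage e N) N e.symm.toLinearMap
      (fun y hy => (mem_grassmannianImage e N y).1 hy) x
  · intro hx
    have h := mem_map_of_forall f N (grassmannianImage e N) e.toLinearMap
      (fun y hy => ⟨y, hy, rfl⟩) _ hx
    convert h
    exact ((e.baseChange ℂ S M M').apply_symm_apply x).symm

theorem grassmannianImage_refl (N : Gr R M k) :
    grassmannianImage (LinearEquiv.refl ℂ M) N = N := by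
  apply Module.Grassmannian.ext
  ext x
  rw [mem_grassmannianImage]
  convert Iff.rfl
  exact (LinearMap.congr_fun (LinearMap.baseChange_id (R := ℂ) (A := R) (M := M)) x).symm

theorem grassmannianImage_trans {M'' : Type u} [AddCommGroup M''] [Module ℂ M'']
    (e : M ≃ₗ[ℂ] M') (e' : M' ≃ₗ[ℂ] M'') (N : Gr R M k) :
    grassmannianImage (e.trans e') N = grassmannianImage e' (grassmannianImage e N) := by
  apply Module.Grassmannian.ext
  ext x
  rw [mem_grassmannianImage, mem_grassmannianImage, mem_grassmannianImage]
  convert Iff.rfl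
  exact (LinearMap.congr_fun
    (LinearMap.baseChange_comp (A := R) e'.symm.toLinearMap e.symm.toLinearMap) x).symm

end BaseChange

/-- The moduli space `M_{v,i}`, given by its functor of points on commutative `ℂ`-algebras.
A homomorphism `R → S` acts by base change of the quotient module `M`. -/
def moduli (v : F.Tile → ℕ) (i : F.Tile) : CommAlgCat.{0} ℂ ⥤ Type u where
  obj R := F.FramedPoint v i R
  map f := ↾fun N => {
    ker := fun j => Module.Grassmannian.map (M := F.corner i j) f.hom (N.ker j)
    rmul_mem := fun j k a x hx =>
      mem_map_of_forall (M := F.corner i j) (M' := F.corner i k)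
        f.hom (N.ker j) (N.ker k) (F.rmul i a) (N.rmul_mem j k a) x hx }
  map_id R := by
    refine ConcreteCategory.hom_ext _ _ fun (N : F.FramedPoint v i R) => ?_
    exact FramedPoint.ext (funext fun j =>
      Module.Grassmannian.map_id (M := F.corner i j) _ R (N.ker j))
  map_comp {R _ _} f g := by
    refine ConcreteCategory.hom_ext _ _ fun (N : F.FramedPoint v i R) => ?_
    exact FramedPoint.ext (funext fun j =>
      Module.Grassmannian.map_comp (M := F.corner i j) _ f.hom g.hom (N.ker j))

/-- The automorphism `t` of `A_F` sends the kernel `N` of `f : e_i A_F → M` to `t N`. -/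
def actPoint (t : F.relationTorus) {v : F.Tile → ℕ} {i : F.Tile} {R : Type} [CommRing R]
    [Algebra ℂ R] (N : F.FramedPoint v i R) : F.FramedPoint v i R where
  ker j := grassmannianImage (M := F.corner i j) (F.actCorner t i j) (N.ker j)
  rmul_mem j k a x hx := by
    obtain ⟨y, hy, rfl⟩ := hx
    refine ⟨_, N.rmul_mem j k ⟨F.act t⁻¹ a, F.act_mem_corner _ a.2⟩ y hy, ?_⟩
    have key : (F.actCorner t i k).toLinearMap ∘ₗ
        F.rmul i ⟨F.act t⁻¹ a, F.act_mem_corner _ a.2⟩ =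
        F.rmul i a ∘ₗ (F.actCorner t i j).toLinearMap := by
      ext x
      change F.act t ((x : F.Alg) * F.act t⁻¹ a) = F.act t x * a
      rw [map_mul, ← AlgEquiv.mul_apply, ← map_mul, mul_inv_cancel, map_one, AlgEquiv.one_apply]
    have := congrArg (fun h => LinearMap.baseChange R h y) key
    rw [LinearMap.baseChange_comp, LinearMap.baseChange_comp] at this
    exact this

theorem actPoint_one {v : F.Tile → ℕ} {i : F.Tile} {R : Type} [CommRing R]
    [Algebra ℂ R] (N : F.FramedPoint v i R) : F.actPoint 1 N = N :=
  FramedPoint.ext (funext fun j => by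
    simp only [actPoint, actCorner_one]
    exact grassmannianImage_refl (M := F.corner i j) (N.ker j))

theorem actPoint_mul (s t : F.relationTorus) {v : F.Tile → ℕ} {i : F.Tile} {R : Type} [CommRing R]
    [Algebra ℂ R] (N : F.FramedPoint v i R) :
    F.actPoint (s * t) N = F.actPoint s (F.actPoint t N) :=
  FramedPoint.ext (funext fun j => by
    simp only [actPoint, actCorner_mul]
    exact grassmannianImage_trans (M := F.corner i j) (M' := F.corner i j) (M'' := F.corner i j)
      (F.actCorner t i j) (F.actCorner s i j) (N.ker j))

/-- The action of an element of `T'` on a moduli space. -/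
def actModuli (t : F.relationTorus) (v : F.Tile → ℕ) (i : F.Tile) : F.moduli v i ⟶ F.moduli v i where
  app R := ↾fun N => F.actPoint t N
  naturality R S f := by
    refine ConcreteCategory.hom_ext _ _ fun (N : F.FramedPoint v i R) => ?_
    exact FramedPoint.ext (funext fun j =>
      (map_grassmannianImage (M := F.corner i j) (M' := F.corner i j) f.hom
        (F.actCorner t i j) (N.ker j)).symm)

theorem actModuli_one (v : F.Tile → ℕ) (i : F.Tile) : F.actModuli 1 v i = 𝟙 _ := by
  ext R : 2
  exact ConcreteCategory.hom_ext _ _ fun (N : F.FramedPoint v i R) => F.actPoint_one N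

theorem actModuli_mul (s t : F.relationTorus) (v : F.Tile → ℕ) (i : F.Tile) :
    F.actModuli (s * t) v i = F.actModuli t v i ≫ F.actModuli s v i := by
  ext R : 2
  exact ConcreteCategory.hom_ext _ _ fun (N : F.FramedPoint v i R) => F.actPoint_mul s t N

/-- The homomorphism `θ : T' → ∏ Aut(M_{v,i})`. -/
def θ (i : F.Tile) : F.relationTorus →* ∀ v : F.Tile → ℕ, Aut (F.moduli v i) where
  toFun t v :=
    { hom := F.actModuli t v i
      inv := F.actModuli t⁻¹ v i
      hom_inv_id := by rw [← actModuli_mul, inv_mul_cancel, actModuli_one]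
      inv_hom_id := by rw [← actModuli_mul, mul_inv_cancel, actModuli_one] }
  map_one' := funext fun v => Iso.ext (F.actModuli_one v i)
  map_mul' s t := funext fun v => Iso.ext (F.actModuli_mul s t v i)

/-! ### The torus `T_W` -/

/-- A subtorus of `(ℂ^*)^E`: the image of a homomorphism of algebraic groups from some torus
`(ℂ^*)^n`, that is, of a homomorphism given by Laurent monomials. -/
def IsSubtorus (H : Subgroup (E → ℂˣ)) : Prop :=
  ∃ (n : ℕ) (m : E → Fin n → ℤ),
    (H : Set (E → ℂˣ)) = Set.range fun (s : Fin n → ℂˣ) e => ∏ k, s k ^ m e k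

/-- The largest subtorus of `(ℂ^*)^E` contained in a subgroup `S`: the subgroup generated by all
subtori contained in `S` (it is a subtorus, as the product of two subtori is one). -/
def largestSubtorus (S : Subgroup (E → ℂˣ)) : Subgroup (E → ℂˣ) :=
  sSup {H | IsSubtorus H ∧ H ≤ S}

/-- The elements of `T'` acting with trivial weight on the simple loop `ω_i`. -/
def loopStabilizer (i : F.Tile) : Subgroup F.relationTorus where
  carrier := {t | ∀ l, F.IsSimpleLoop i l → F.act t (F.cls i l) = F.cls i l}
  one_mem' l _ := by rw [map_one, AlgEquiv.one_apply]
  mul_mem' hs ht l hl := by rw [map_mul, AlgEquiv.mul_apply, ht l hl, hs l hl]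
  inv_mem' {t} ht l hl := by
    conv_lhs => rw [← ht l hl]
    rw [← AlgEquiv.mul_apply, ← map_mul, inv_mul_cancel, map_one, AlgEquiv.one_apply]

/-- `T'_W`: the largest subtorus of `T'` acting with trivial weight on the simple loop `ω_i`. -/
def TW' (i : F.Tile) : Subgroup F.relationTorus :=
  (largestSubtorus ((F.loopStabilizer i).map F.relationTorus.subtype)).subgroupOf F.relationTorus

/-- `T_W`: the image of `T'_W` under `θ`. -/
def TW (i : F.Tile) : Subgroup (∀ v : F.Tile → ℕ, Aut (F.moduli v i)) := (F.TW' i).map (F.θ i)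

/-- The surjection `T'_W → T_W` given by `θ`. -/
def toTW (i : F.Tile) : F.TW' i →* F.TW i := (F.θ i).subgroupMap (F.TW' i)

instance (i : F.Tile) : CommGroup (F.TW i) :=
  { (inferInstance : Group (F.TW i)) with
    mul_comm := by
      rintro ⟨_, s, -, rfl⟩ ⟨_, t, -, rfl⟩
      exact Subtype.ext (((F.θ i).map_mul s t).symm.trans
        ((congrArg (F.θ i) (mul_comm s t)).trans ((F.θ i).map_mul t s))) }

/-- The (algebraic) characters of `T_W`, where `T_W` carries the structure of an algebraic group
as a quotient of the torus `T'_W`: the homomorphisms `χ : T_W → ℂ^*` whose pullback to `T'_W` is a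
character of `T'_W`, that is, the restriction of a Laurent monomial on `(ℂ^*)^E`. -/
def IsCharacter (i : F.Tile) (χ : F.TW i →* ℂˣ) : Prop :=
  ∃ m : E → ℤ, ∀ t : F.TW' i, χ (F.toTW i t) = ∏ e, (t : F.relationTorus).1 e ^ m e

/-- The algebraic group `T_W` is a torus of dimension `n`: it is isomorphic to `(ℂ^*)^n` by an
isomorphism identifying the characters of `T_W` with the Laurent monomials on `(ℂ^*)^n`. -/
def IsTorusOfDim (i : F.Tile) (n : ℕ) : Prop :=
  ∃ ψ : F.TW i ≃* (Fin n → ℂˣ), ∀ χ : F.TW i →* ℂˣ,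
    F.IsCharacter i χ ↔ ∃ m : Fin n → ℤ, ∀ x, χ x = ∏ k, ψ x k ^ m k

/-- The cocharacter lattice of `T_W`: the homomorphisms `α : ℂ^* → T_W` which are algebraic, that
is, whose composition with each character of `T_W` is of the form `z ↦ z ^ n`. -/
def cocharacters (i : F.Tile) : Subgroup (ℂˣ →* F.TW i) where
  carrier := {α | ∀ χ, F.IsCharacter i χ → ∃ n : ℤ, ∀ z, χ (α z) = z ^ n}
  one_mem' χ _ := ⟨0, fun z => by simp⟩
  mul_mem' hα hβ χ hχ := by
    obtain ⟨n, hn⟩ := hα χ hχ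
    obtain ⟨m, hm⟩ := hβ χ hχ
    exact ⟨n + m, fun z => by rw [MonoidHom.mul_apply, map_mul, hn, hm, zpow_add]⟩
  inv_mem' hα χ hχ := by
    obtain ⟨n, hn⟩ := hα χ hχ
    exact ⟨-n, fun z => by rw [MonoidHom.inv_apply, map_inv, hn, zpow_neg]⟩

end BraneTiling

end

noncomputable section

namespace BraneTiling

/-! ### Cycles of a permutation -/

section Turn

variable {E : Type u} [Finite E] (p : Equiv.Perm E)

/-! Let C₂ → C₁ → C₀ be the cellular complex with differentials `d₂` and `d₁`. A rescaling t is a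
homomorphism C₁ → ℂ*. Each relation of A_F equates two paths, the returns from the head of an arrow
to its tail along its black and along its white cycle. If t preserves the relations, the two cycles
through any edge have equal weight. Trivial weight on one simple loop therefore spreads, by
connectedness, to the cycles around all vertices, so the stabilizer of ω_i is Hom(C₁/im d₂, ℂ*)
(`map_loopStabilizer`). Since C₁/im d₂ is torsion-free, this group is already a torus and equals
T'_W (`mem_TW'_iff`).

The kernel of θ consists of the t with trivial weight on all i-loops (`θ_eq_one_iff`). Such a t is
the coboundary of a potential σ on the tiles, so it acts on A_F as conjugation by ∑ σ_k e_k, hence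
by a scalar on each e_j A_F e_k, and it fixes every submodule. Conversely, the representation of
dimension vector (1, …, 1) with all arrows acting as identities gives a point of a moduli space
whose kernel contains u − e_i for every i-loop u; fixing that point forces weight 1 on u. The same
representation shows that classes of paths are nonzero, so that weights can be read off in A_F.

A coboundary is trivial on all 1-cycles, so T_W embeds in Hom(H₁, ℂ*). The embedding is onto because
ker d₁ is a direct summand of C₁ (`exists_basis_H₁`). Finally H₁ is free of rank 2g by
torsion-freeness and Euler's formula (`finrank_H₁`), and the cocharacters of Hom(H₁, ℂ*) form the
dual of H₁. -/

theorem mem_periodicPts (a : E) : a ∈ Function.periodicPts p :=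
  p.injective.mem_periodicPts a

theorem coe_turn {E : Type u} (p : Equiv.Perm E) (a : E) :
    (turn p a : Cycle E) = Function.periodicOrbit p a := by
  rw [turn, Function.periodicOrbit_def, List.range_map_iterate]

theorem nodup_turn {E : Type u} (p : Equiv.Perm E) (a : E) : (turn p a).Nodup := by
  have := Function.nodup_periodicOrbit (f := p) (x := a)
  rwa [← coe_turn, Cycle.nodup_coe_iff] at this

theorem mem_turn {a b : E} : b ∈ turn p a ↔ p.SameCycle a b := by
  rw [← Cycle.mem_coe_iff, coe_turn, Function.mem_periodicOrbit_iff (mem_periodicPts p a)]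
  constructor
  · rintro ⟨n, rfl⟩
    exact ⟨n, by rw [zpow_natCast, Equiv.Perm.iterate_eq_pow]⟩
  · intro h
    obtain ⟨n, -, hn⟩ := h.exists_pow_eq'
    exact ⟨n, by rw [Equiv.Perm.iterate_eq_pow, hn]⟩

theorem turn_eq_cons (a : E) : turn p a = a :: (turn p a).tail := by
  have h := Function.minimalPeriod_pos_of_mem_periodicPts (mem_periodicPts p a)
  obtain ⟨n, hn⟩ := Nat.exists_eq_succ_of_ne_zero h.ne'
  rw [turn, hn]
  rfl

theorem coe_turn_eq_of_sameCycle {a b : E} (h : p.SameCycle a b) :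
    (turn p b : Cycle E) = turn p a := by
  obtain ⟨n, -, rfl⟩ := h.exists_pow_eq'
  rw [coe_turn, coe_turn, ← Equiv.Perm.iterate_eq_pow,
    Function.periodicOrbit_apply_iterate_eq (mem_periodicPts p a)]

/-- The edges of a cycle are distinct, so a rotation of it is determined by its first entry. -/
theorem eq_turn_of_coe_eq {a b : E} {l : List E} (hl : (l : Cycle E) = turn p b)
    (ha : l.head? = some a) : p.SameCycle b a ∧ l = turn p a := by
  have hal : a ∈ l := List.mem_of_mem_head? ha
  have hb : p.SameCycle b a := by
    rwa [← mem_turn, ← Cycle.mem_coe_iff, ← hl, Cycle.mem_coe_iff]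
  refine ⟨hb, ?_⟩
  rw [← coe_turn_eq_of_sameCycle p hb, Cycle.coe_eq_coe] at hl
  obtain ⟨n, hn, rfl⟩ := List.isRotated_iff_mod.1 hl.symm
  have hlen : 0 < (turn p a).length := by rw [turn_eq_cons]; simp
  rw [← List.rotate_mod, List.head?_rotate (Nat.mod_lt _ hlen)] at ha
  have h0 : (turn p a)[0]? = some a := by rw [turn_eq_cons]; rfl
  have := (List.getElem?_inj (Nat.mod_lt n hlen) (nodup_turn p a)).1 (ha.trans h0.symm)
  rw [← List.rotate_mod, this, List.rotate_zero]

-- An arrow occurs at most once in the cycle around a vertex, so `cyclicDeriv` of such a cycle has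
-- at most one term.
open Classical in
theorem filter_lists_turn (a b : E) :
    ((turn p b : Cycle E).lists.filter fun l => l.head? = some a) =
      if p.SameCycle b a then {turn p a} else 0 := by
  have hnd : ((turn p b : Cycle E).lists.filter fun l => l.head? = some a).Nodup := by
    refine Multiset.Nodup.filter _ ?_
    rw [Cycle.lists_coe, Multiset.coe_nodup]
    exact (nodup_turn p b).cyclicPermutations
  split_ifs with h
  · refine (Multiset.Nodup.ext hnd (Multiset.nodup_singleton _)).2 fun l => ?_
    rw [Multiset.mem_filter, Cycle.mem_lists_iff_coe_eq, Multiset.mem_singleton]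
    constructor
    · rintro ⟨h₁, h₂⟩
      exact (eq_turn_of_coe_eq p h₁ h₂).2
    · rintro rfl
      exact ⟨coe_turn_eq_of_sameCycle p h, by rw [turn_eq_cons]; rfl⟩
  · refine Multiset.eq_zero_of_forall_notMem fun l hl => h ?_
    rw [Multiset.mem_filter, Cycle.mem_lists_iff_coe_eq] at hl
    exact (eq_turn_of_coe_eq p hl.1 hl.2).1

end Turn

variable {E : Type u} [Fintype E] (F : BraneTiling E)

/-! ### Connectedness -/

/-- A property of edges inherited by the next edge around either endpoint and satisfied by some
edge is satisfied by all edges. -/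
theorem forall_of_step {P : E → Prop} (hb : ∀ e, P e → P (F.black e))
    (hw : ∀ e, P e → P (F.white e)) {e₀ : E} (h₀ : P e₀) (e : E) : P e := by
  have key : ∀ p : Equiv.Perm E, (∀ e, P e → P (p e)) → ∀ e, P (p e) ↔ P e := by
    intro p hp e
    refine ⟨fun h => ?_, hp e⟩
    have hn : ∀ (n : ℕ) (e : E), P e → P ((p ^ n) e) := by
      intro n
      induction n with
      | zero => exact fun _ h => h
      | succ n ih => exact fun e h => by rw [pow_succ']; exact hp _ (ih e h)
    -- A permutation of a finite set has finite order, so its inverse is one of its powers and the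
    -- property also passes backwards.
    have := hn (orderOf p - 1) _ h
    rwa [← Equiv.Perm.mul_apply, ← pow_succ, Nat.sub_add_cancel (orderOf_pos p),
      pow_orderOf_eq_one] at this
  have := F.connected
  obtain ⟨⟨q, hq⟩, rfl⟩ := MulAction.exists_smul_eq
    (Subgroup.closure ({F.black, F.white} : Set (Equiv.Perm E))) e₀ e
  refine (?_ : P (q e₀) ↔ P e₀).2 h₀
  clear h₀
  revert e₀
  change ∀ e₀, P (q e₀) ↔ P e₀
  induction hq using Subgroup.closure_induction with
  | mem x hx =>
    rcases hx with rfl | rfl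
    · exact key _ hb
    · exact key _ hw
  | one => exact fun _ => Iff.rfl
  | mul x y _ _ hx hy => exact fun e => (hx _).trans (hy e)
  | inv x _ hx => exact fun e => by rw [← hx]; simp

theorem IsPath.append {i j k : F.Tile} {l l' : List E} (h : F.IsPath i j l)
    (h' : F.IsPath j k l') : F.IsPath i k (l ++ l') := by
  induction l generalizing i with
  | nil => obtain rfl : i = j := h; exact h'
  | cons a l ih => exact ⟨h.1, ih h.2⟩

theorem isPath_singleton (a : E) : F.IsPath (F.tail a) (F.head a) [a] := ⟨rfl, rfl⟩

theorem exists_tail_eq (j : F.Tile) : ∃ a, F.tail a = j := Quotient.exists_rep j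

/-- The dual quiver is strongly connected. -/
theorem exists_isPath (i j : F.Tile) : ∃ l, F.IsPath i j l := by
  obtain ⟨a, rfl⟩ := F.exists_tail_eq i
  obtain ⟨b, rfl⟩ := F.exists_tail_eq j
  -- The arrow `e` leads from its tail to the tails of both `black e` and `white e`, so reachability
  -- is inherited in both directions of the induction.
  refine F.forall_of_step (P := fun b => ∃ l, F.IsPath (F.tail a) (F.tail b) l) ?_ ?_
    (e₀ := a) ⟨[], rfl⟩ b
  · rintro e ⟨l, hl⟩
    exact ⟨_, hl.append F (F.isPath_singleton e)⟩
  · rintro e ⟨l, hl⟩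
    refine ⟨l ++ [e], ?_⟩
    rw [← F.head_eq_tail_white]
    exact hl.append F (F.isPath_singleton e)

theorem isPath_iterate {p : Equiv.Perm E} (hp : ∀ a, F.head a = F.tail (p a)) (n : ℕ) (a : E) :
    F.IsPath (F.tail a) (F.tail (p^[n] a)) (List.iterate p a n) := by
  induction n generalizing a with
  | zero => rfl
  | succ n ih => exact ⟨rfl, by rw [hp]; exact ih (p a)⟩

theorem isPath_turn {p : Equiv.Perm E} (hp : ∀ a, F.head a = F.tail (p a)) (a : E) :
    F.IsPath (F.tail a) (F.tail a) (turn p a) := by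
  have := F.isPath_iterate hp (Function.minimalPeriod p a) a
  rwa [Function.iterate_minimalPeriod] at this

theorem IsSimpleLoop.isPath {i : F.Tile} {l : List E} (h : F.IsSimpleLoop i l) :
    F.IsPath i i l := by
  obtain ⟨a, rfl, rfl | rfl⟩ := h
  · exact F.isPath_turn (fun _ => rfl) a
  · exact F.isPath_turn F.head_eq_tail_white a

theorem isPath_turn_tail {p : Equiv.Perm E} (hp : ∀ a, F.head a = F.tail (p a)) (a : E) :
    F.IsPath (F.head a) (F.tail a) (turn p a).tail := by
  have := F.isPath_turn hp a
  rw [turn_eq_cons] at this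
  exact this.2

/-! ### Superpotential relations -/

theorem cyclicDeriv_single_turn (p : Equiv.Perm E) (a b : E) [Decidable (p.SameCycle b a)] :
    F.cyclicDeriv a (Finsupp.single (turn p b : Cycle E) 1) =
      if p.SameCycle b a then F.word (F.head a) (turn p a).tail else 0 := by
  rw [cyclicDeriv, Finsupp.linearCombination_single, one_smul, filter_lists_turn]
  split_ifs <;> simp

/-- Every arrow lies on exactly one black and one white cycle, so each relation is a difference of
two paths with the same endpoints. -/
theorem cyclicDeriv_superpotential (a : E) :
    F.cyclicDeriv a F.superpotential =
      F.word (F.head a) (turn F.black a).tail - F.word (F.head a) (turn F.white a).tail := by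
  classical
  have key : ∀ (p : Equiv.Perm E) [Fintype (Quotient (Equiv.Perm.SameCycle.setoid p))],
      F.cyclicDeriv a (∑ v : Quotient (Equiv.Perm.SameCycle.setoid p),
        Finsupp.single (turn p v.out : Cycle E) 1) = F.word (F.head a) (turn p a).tail := by
    intro p _
    rw [map_sum]
    simp_rw [cyclicDeriv_single_turn]
    rw [Finset.sum_eq_single (Quotient.mk _ a)]
    · exact if_pos (Quotient.exact (s := Equiv.Perm.SameCycle.setoid p) (Quotient.out_eq _))
    · intro v _ hv
      refine if_neg fun h => hv ?_
      rw [← Quotient.out_eq v]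
      exact Quotient.sound h
    · simp
  rw [superpotential, map_sub, key, key]

/-! ### Rescaling paths -/

theorem rescale_word (t : E → ℂˣ) (i : F.Tile) (l : List E) :
    F.rescale t (F.word i l) = ((l.map t).prod : ℂ) • F.word i l := by
  have key : F.rescale t (l.map F.arr).prod = ((l.map t).prod : ℂ) • (l.map F.arr).prod := by
    induction l with
    | nil => simp
    | cons a l ih => simp [ih, rescale_arr, smul_smul, mul_comm]
  rw [word, map_mul, rescale_vtx, key, mul_smul_comm]

theorem act_toAlg (t : F.relationTorus) (x : F.PathAlgebra) :
    F.act t (F.toAlg x) = F.toAlg (F.rescale t x) :=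
  F.actHom_toAlg t x

theorem act_cls (t : F.relationTorus) (i : F.Tile) (l : List E) :
    F.act t (F.cls i l) = ((l.map t.1).prod : ℂ) • F.cls i l := by
  rw [cls, act_toAlg, rescale_word, map_smul]

/-! ### The representation of dimension vector `(1, …, 1)` on which all arrows act as identities -/

section Rep
open Classical Matrix

/-- The representation of the path algebra sending a path from `i` to `j` to the matrix unit
`(i, j)`. -/
def pathRep : F.PathAlgebra →ₐ[ℂ] Matrix F.Tile F.Tile ℂ :=
  F.liftPath (FreeAlgebra.lift ℂ (Sum.elim (fun i => Matrix.single i i 1)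
    fun a => Matrix.single (F.tail a) (F.head a) 1)) <| by
    intro x y h
    cases h with
    | idem i => simp
    | orth i j h => simp [Matrix.single_mul_single_of_ne _ _ _ _ h]
    | one =>
      simp only [map_sum, map_one, FreeAlgebra.lift_ι_apply, Sum.elim_inl]
      ext a b
      simp [Matrix.sum_apply, Matrix.single_apply, Matrix.one_apply, ite_and]
    | tail a => simp
    | head a => simp

theorem pathRep_vtx (i : F.Tile) : F.pathRep (F.vtx i) = Matrix.single i i 1 :=
  (F.liftPath_apply _ _ _).trans (by rw [FreeAlgebra.lift_ι_apply]; rfl)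

theorem pathRep_arr (a : E) : F.pathRep (F.arr a) = Matrix.single (F.tail a) (F.head a) 1 :=
  (F.liftPath_apply _ _ _).trans (by rw [FreeAlgebra.lift_ι_apply]; rfl)

theorem pathRep_word {i j : F.Tile} {l : List E} (h : F.IsPath i j l) :
    F.pathRep (F.word i l) = Matrix.single i j 1 := by
  rw [word, map_mul, pathRep_vtx]
  induction l generalizing i with
  | nil => obtain rfl : i = j := h; simp
  | cons a l ih =>
    obtain ⟨rfl, h⟩ := h
    have hs : (Matrix.single (F.tail a) (F.head a) 1 : Matrix F.Tile F.Tile ℂ) =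
        Matrix.single (F.tail a) (F.head a) 1 * Matrix.single (F.head a) (F.head a) 1 := by
      rw [Matrix.single_mul_single_same, one_mul]
    rw [List.map_cons, List.prod_cons, map_mul, pathRep_arr, ← mul_assoc,
      Matrix.single_mul_single_same, one_mul, hs, mul_assoc, ih h,
      Matrix.single_mul_single_same, one_mul]

/-- The representation of `A_F` sending a path from `i` to `j` to the matrix unit `(i, j)`. -/
def algRep : F.Alg →ₐ[ℂ] Matrix F.Tile F.Tile ℂ :=
  F.liftAlg F.pathRep fun a => by
    -- Both terms of the relation run from `head a` to `tail a`, so they have the same matrix unit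
    -- as image.
    rw [cyclicDeriv_superpotential, map_sub, F.pathRep_word (F.isPath_turn_tail (fun _ => rfl) a),
      F.pathRep_word (F.isPath_turn_tail F.head_eq_tail_white a), sub_self]

theorem algRep_cls {i j : F.Tile} {l : List E} (h : F.IsPath i j l) :
    F.algRep (F.cls i l) = Matrix.single i j 1 :=
  (F.liftAlg_apply _ _ _).trans (F.pathRep_word h)

theorem algRep_idem (i : F.Tile) : F.algRep (F.idem i) = Matrix.single i i 1 :=
  (F.liftAlg_apply _ _ _).trans (F.pathRep_vtx i)

theorem algRep_corner {i j : F.Tile} {x : F.Alg} (hx : x ∈ F.corner i j) :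
    F.algRep x = Matrix.single i j (F.algRep x i j) := by
  have h : x = F.idem i * x * F.idem j := by rw [hx.1, hx.2]
  conv_lhs => rw [h, map_mul, map_mul, algRep_idem, algRep_idem]
  ext a b
  simp [Matrix.single_mul_mul_single]

/-- A matrix unit is nonzero. This is what allows a weight to be recovered from the action on the
class of a path. -/
theorem cls_ne_zero {i j : F.Tile} {l : List E} (h : F.IsPath i j l) : F.cls i l ≠ 0 := by
  intro h0
  have := F.algRep_cls h
  rw [h0, map_zero] at this
  simpa using congrFun (congrFun this i) j

end Rep

theorem cls_mem_corner {i j : F.Tile} {l : List E} (h : F.IsPath i j l) :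
    F.cls i l ∈ F.corner i j := by
  have hidem (k : F.Tile) : F.vtx k * F.vtx k = F.vtx k := by
    rw [vtx, ← map_mul, F.toPathAlgebra_rel (.idem k)]
  have htail (a : E) : F.vtx (F.tail a) * F.arr a = F.arr a := by
    rw [vtx, arr, ← map_mul, F.toPathAlgebra_rel (.tail a)]
  have hhead (a : E) : F.arr a * F.vtx (F.head a) = F.arr a := by
    rw [vtx, arr, ← map_mul, F.toPathAlgebra_rel (.head a)]
  have key : F.word i l * F.vtx j = F.word i l := by
    rw [word]
    induction l generalizing i with
    | nil => obtain rfl : i = j := h; simp [hidem]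
    | cons a l ih =>
      obtain ⟨rfl, h⟩ := h
      rw [List.map_cons, List.prod_cons, ← mul_assoc, htail, ← hhead, mul_assoc (F.arr a),
        mul_assoc, ih h]
  constructor
  · rw [idem, cls, ← map_mul, word, ← mul_assoc, hidem]
  · rw [idem, cls, ← map_mul, key]

/-! ### The weight of a rescaling on a 1-chain -/

/-- The weight `∏ e, t e ^ x e` with which a rescaling `t` of the edges acts on a 1-chain `x`. -/
def weight {E : Type u} (t : E → ℂˣ) : (E →₀ ℤ) →ₗ[ℤ] Additive ℂˣ :=
  Finsupp.linearCombination ℤ fun e => Additive.ofMul (t e)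

theorem weight_single {E : Type u} (t : E → ℂˣ) (e : E) :
    weight t (Finsupp.single e 1) = Additive.ofMul (t e) := by
  simp [weight]

theorem weight_apply (t : E → ℂˣ) (x : E →₀ ℤ) :
    weight t x = Additive.ofMul (∏ e, t e ^ x e) := by
  rw [weight, Finsupp.linearCombination_apply, Finsupp.sum_fintype _ _ (by simp), ofMul_prod]
  rfl

theorem weight_chain {E : Type u} (t : E → ℂˣ) (l : List E) :
    weight t (chain l) = Additive.ofMul (l.map t).prod := by
  induction l with
  | nil => simp [chain]
  | cons a l ih =>
    have hc : chain (a :: l) = Finsupp.single a 1 + chain l := by simp [chain]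
    rw [hc, map_add, ih, weight_single, List.map_cons, List.prod_cons, ofMul_mul]

theorem weight_mul (s t : E → ℂˣ) (x : E →₀ ℤ) :
    weight (s * t) x = weight s x + weight t x := by
  simp only [weight_apply, Pi.mul_apply, mul_zpow, Finset.prod_mul_distrib, ofMul_mul]

theorem weight_eq_of_single {E : Type u} {t : E → ℂˣ} {f : (E →₀ ℤ) →ₗ[ℤ] Additive ℂˣ}
    (h : ∀ e, f (Finsupp.single e 1) = Additive.ofMul (t e)) : weight t = f := by
  ext e
  simp [weight_single, h]

theorem chain_turn {E : Type u} [Fintype E] (p : Equiv.Perm E) (a : E)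
    [DecidablePred fun b => p.SameCycle b a] :
    chain (turn p a) = ∑ b with p.SameCycle b a, Finsupp.single b 1 := by
  classical
  rw [chain, ← List.sum_toFinset _ (nodup_turn p a)]
  refine Finset.sum_congr ?_ fun _ _ => rfl
  ext b
  simp [mem_turn, Equiv.Perm.sameCycle_comm]

theorem d₂_black (a : E) :
    F.d₂ (Finsupp.single (Sum.inl (F.blackEnd a)) 1) = chain (turn F.black a) := by
  classical
  rw [d₂, Finsupp.linearCombination_single, one_smul, Sum.elim_inl, chain_turn]
  refine Finset.sum_congr ?_ fun _ _ => rfl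
  ext b
  simp only [Finset.mem_filter, Finset.mem_univ, true_and]
  exact Quotient.eq (r := Equiv.Perm.SameCycle.setoid F.black)

theorem d₂_white (a : E) :
    F.d₂ (Finsupp.single (Sum.inr (F.whiteEnd a)) 1) = -chain (turn F.white a) := by
  classical
  rw [d₂, Finsupp.linearCombination_single, one_smul, Sum.elim_inr, chain_turn]
  congr 1
  refine Finset.sum_congr ?_ fun _ _ => rfl
  ext b
  simp only [Finset.mem_filter, Finset.mem_univ, true_and]
  exact Quotient.eq (r := Equiv.Perm.SameCycle.setoid F.white)

/-- The group of rescalings of the edges that act trivially on the cycles around all vertices. -/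
def cocycles : Subgroup (E → ℂˣ) where
  carrier := {t | ∀ x, weight t (F.d₂ x) = 0}
  one_mem' x := by simp [weight_apply]
  mul_mem' hs ht x := by rw [weight_mul, hs, ht, add_zero]
  inv_mem' {t} ht x := by
    have h := weight_mul t⁻¹ t (F.d₂ x)
    rw [ht, add_zero, inv_mul_cancel] at h
    rw [← h]
    simp [weight_apply]

theorem mem_cocycles_iff (t : E → ℂˣ) : t ∈ F.cocycles ↔
    ∀ a, ((turn F.black a).map t).prod = 1 ∧ ((turn F.white a).map t).prod = 1 := by
  constructor
  · intro h a
    have hb := h (Finsupp.single (Sum.inl (F.blackEnd a)) 1)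
    have hw := h (Finsupp.single (Sum.inr (F.whiteEnd a)) 1)
    rw [d₂_black, weight_chain] at hb
    rw [d₂_white, map_neg, neg_eq_zero, weight_chain] at hw
    exact ⟨hb, hw⟩
  · intro h
    suffices hz : weight t ∘ₗ F.d₂ = 0 from LinearMap.congr_fun hz
    ext v
    rcases v with v | v
    · obtain ⟨a, rfl⟩ : ∃ a, F.blackEnd a = v := Quotient.exists_rep v
      simp [d₂_black, weight_chain, (h a).1]
    · obtain ⟨a, rfl⟩ : ∃ a, F.whiteEnd a = v := Quotient.exists_rep v
      simp [d₂_white, weight_chain, (h a).2]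

/-! ### The stabilizer of the simple loops -/

theorem prod_turn_eq_mul_tail {E : Type u} [Finite E] (p : Equiv.Perm E) (t : E → ℂˣ) (a : E) :
    ((turn p a).map t).prod = t a * ((turn p a).tail.map t).prod := by
  conv_lhs => rw [turn_eq_cons, List.map_cons, List.prod_cons]

theorem prod_turn_apply {E : Type u} [Finite E] (p : Equiv.Perm E) (t : E → ℂˣ) (a : E) :
    ((turn p (p a)).map t).prod = ((turn p a).map t).prod := by
  have h := coe_turn_eq_of_sameCycle p (a := a) (b := p a) ⟨1, by simp⟩
  exact ((Cycle.coe_eq_coe.1 h).perm.map t).prod_eq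

theorem smul_cls_injective {i j : F.Tile} {l : List E} (h : F.IsPath i j l) {c d : ℂ}
    (hcd : c • F.cls i l = d • F.cls i l) : c = d :=
  smul_left_injective ℂ (F.cls_ne_zero h) hcd

theorem cls_turn_tail (a : E) :
    F.cls (F.head a) (turn F.black a).tail = F.cls (F.head a) (turn F.white a).tail := by
  have := F.toAlg_rel a
  rwa [cyclicDeriv_superpotential, map_sub, sub_eq_zero] at this

/-- The two sides of the relation at `a` are one nonzero element of A_F. As the rescaled relation
still holds, both sides are scaled alike; multiplying by `t a` completes the two cycles. -/
theorem relationTorus_prod_turn {t : E → ℂˣ} (ht : t ∈ F.relationTorus) (a : E) :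
    ((turn F.black a).map t).prod = ((turn F.white a).map t).prod := by
  have h := (ht _).2 (F.toAlg_rel a)
  rw [cyclicDeriv_superpotential, map_sub, rescale_word, rescale_word, map_sub, sub_eq_zero,
    map_smul, map_smul] at h
  change _ • F.cls _ _ = _ • F.cls _ _ at h
  rw [cls_turn_tail] at h
  have := F.smul_cls_injective (F.isPath_turn_tail F.head_eq_tail_white a) h
  rw [prod_turn_eq_mul_tail, prod_turn_eq_mul_tail, Units.ext this]

/-- With weight 1 on both cycles through `a`, the two terms of the relation at `a` are multiplied by
the same scalar (the inverse of `t a`), so the relation is only rescaled. Applying this to `t⁻¹` as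
well gives the equivalence. -/
theorem mem_relationTorus_of_mem_cocycles {t : E → ℂˣ} (ht : t ∈ F.cocycles) :
    t ∈ F.relationTorus := by
  have key : ∀ t ∈ F.cocycles, ∀ x, F.toAlg x = 0 → F.toAlg (F.rescale t x) = 0 := by
    intro t ht x hx
    have htail : ∀ a, ((turn F.black a).tail.map t).prod = ((turn F.white a).tail.map t).prod := by
      intro a
      have h := (F.mem_cocycles_iff t).1 ht a
      rw [prod_turn_eq_mul_tail, prod_turn_eq_mul_tail] at h
      exact mul_left_cancel (h.1.trans h.2.symm)
    have := F.liftAlg_apply (F.toAlg.comp (F.rescale t)) (fun a => by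
      rw [cyclicDeriv_superpotential, AlgHom.comp_apply, map_sub, rescale_word, rescale_word,
        htail, ← smul_sub, map_smul, ← cyclicDeriv_superpotential, toAlg_rel, smul_zero]) x
    rw [hx, map_zero] at this
    exact this.symm
  refine fun x => ⟨fun h => ?_, key t ht x⟩
  have := key _ (inv_mem ht) _ h
  rwa [← AlgHom.comp_apply (F.rescale t⁻¹), ← F.rescale_mul, inv_mul_cancel, F.rescale_one]
    at this

/-- The weight of the black cycle at an edge is unchanged on moving around either endpoint, because
it agrees with that of the white cycle. By connectedness a single simple loop at `i` controls the
cycles around all vertices. -/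
theorem map_loopStabilizer (i : F.Tile) :
    (F.loopStabilizer i).map F.relationTorus.subtype = F.cocycles := by
  ext t
  constructor
  · rintro ⟨t, ht, rfl⟩
    obtain ⟨a, rfl⟩ := F.exists_tail_eq i
    have hbw := F.relationTorus_prod_turn t.2
    have h₀ : ((turn F.black a).map t.1).prod = 1 := by
      have hl : F.IsSimpleLoop (F.tail a) (turn F.black a) := ⟨a, rfl, Or.inl rfl⟩
      have h := ht _ hl
      rw [act_cls] at h
      nth_rewrite 2 [← one_smul ℂ (F.cls _ _)] at h
      exact Units.ext (F.smul_cls_injective (hl.isPath F) h)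
    have hb : ∀ b, ((turn F.black b).map t.1).prod = 1 :=
      F.forall_of_step (fun e he => by rw [prod_turn_apply, he])
        (fun e he => by rw [hbw, prod_turn_apply, ← hbw, he]) h₀
    exact (F.mem_cocycles_iff _).2 fun b => ⟨hb b, (hbw b).symm.trans (hb b)⟩
  · intro ht
    refine ⟨⟨t, F.mem_relationTorus_of_mem_cocycles ht⟩, ?_, rfl⟩
    rintro l ⟨a, -, rfl | rfl⟩ <;> rw [act_cls]
    · rw [((F.mem_cocycles_iff t).1 ht a).1, Units.val_one, one_smul]
    · rw [((F.mem_cocycles_iff t).1 ht a).2, Units.val_one, one_smul]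

/-! ### The kernel of `θ` -/

/-- The rescaling `t` has trivial weight on all `i`-loops. -/
def LoopTrivial (i : F.Tile) (t : E → ℂˣ) : Prop :=
  ∀ l, F.IsPath i i l → (l.map t).prod = 1

/-- A rescaling of trivial weight on all `i`-loops is a coboundary. -/
theorem LoopTrivial.exists_potential {i : F.Tile} {t : E → ℂˣ} (ht : F.LoopTrivial i t) :
    ∃ σ : F.Tile → ℂˣ, ∀ a, t a * σ (F.tail a) = σ (F.head a) := by
  choose p hp using fun j => F.exists_isPath i j
  -- The potential at `j` is the weight of a chosen path from `i` to `j`. Closing the two paths to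
  -- `head a` by a common return `r` to `i` compares them.
  refine ⟨fun j => ((p j).map t).prod, fun a => ?_⟩
  obtain ⟨r, hr⟩ := F.exists_isPath (F.head a) i
  have h₁ := ht _ (((hp (F.tail a)).append F (F.isPath_singleton a)).append F hr)
  have h₂ := ht _ ((hp (F.head a)).append F hr)
  simp only [List.map_append, List.prod_append, List.map_cons, List.map_nil, List.prod_cons,
    List.prod_nil, mul_one] at h₁ h₂
  rw [mul_comm]
  exact mul_right_cancel (h₁.trans h₂.symm)

/-- The weight of a coboundary factors through `d₁`. Triviality on directed loops at one tile thus
extends to all integral 1-cycles. -/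
theorem LoopTrivial.weight_eq_zero {i : F.Tile} {t : E → ℂˣ} (ht : F.LoopTrivial i t)
    {x : E →₀ ℤ} (hx : F.d₁ x = 0) : weight t x = 0 := by
  obtain ⟨σ, hσ⟩ := ht.exists_potential
  have : weight t = Finsupp.linearCombination ℤ (fun j => Additive.ofMul (σ j)) ∘ₗ F.d₁ := by
    refine weight_eq_of_single fun a => ?_
    rw [LinearMap.comp_apply, d₁, Finsupp.linearCombination_single, one_smul, map_sub,
      Finsupp.linearCombination_single, Finsupp.linearCombination_single, one_smul, one_smul,
      ← hσ a, ← ofMul_div, mul_div_cancel_right]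
  rw [this, LinearMap.comp_apply, hx, map_zero]

theorem idem_mul_idem (j : F.Tile) : F.idem j * F.idem j = F.idem j := by
  rw [idem, ← map_mul, vtx, ← map_mul, F.toPathAlgebra_rel (.idem j)]

theorem idem_mul_idem_of_ne {j k : F.Tile} (h : j ≠ k) : F.idem j * F.idem k = 0 := by
  rw [idem, idem, ← map_mul, vtx, vtx, ← map_mul, F.toPathAlgebra_rel (.orth j k h), map_zero,
    map_zero]

theorem idem_mul_sum (σ : F.Tile → ℂ) (j : F.Tile) :
    F.idem j * ∑ k, σ k • F.idem k = σ j • F.idem j := by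
  rw [Finset.mul_sum, Finset.sum_eq_single j]
  · rw [mul_smul_comm, idem_mul_idem]
  · intro k _ hk
    rw [mul_smul_comm, F.idem_mul_idem_of_ne hk.symm, smul_zero]
  · simp

theorem sum_mul_idem (σ : F.Tile → ℂ) (j : F.Tile) :
    (∑ k, σ k • F.idem k) * F.idem j = σ j • F.idem j := by
  rw [Finset.sum_mul, Finset.sum_eq_single j]
  · rw [smul_mul_assoc, idem_mul_idem]
  · intro k _ hk
    rw [smul_mul_assoc, F.idem_mul_idem_of_ne hk, smul_zero]
  · simp

theorem toAlg_toPathAlgebra_surjective :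
    Function.Surjective (F.toAlg.comp F.toPathAlgebra) :=
  (RingQuot.mkAlgHom_surjective ℂ F.FTerm).comp (RingQuot.mkAlgHom_surjective ℂ F.PathRel)

/-- The coboundary of σ acts as the inner automorphism x ↦ D⁻¹ x D with D = ∑ σ_k e_k. The identity
is multiplicative in x, so it suffices to check idempotents and arrows. -/
theorem sum_mul_act (t : F.relationTorus) {σ : F.Tile → ℂˣ}
    (hσ : ∀ a, t.1 a * σ (F.tail a) = σ (F.head a)) (x : F.Alg) :
    (∑ k, (σ k : ℂ) • F.idem k) * F.act t x = x * ∑ k, (σ k : ℂ) • F.idem k := by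
  set D := ∑ k, (σ k : ℂ) • F.idem k with hD
  obtain ⟨x, rfl⟩ := F.toAlg_toPathAlgebra_surjective x
  induction x using FreeAlgebra.induction with
  | grade0 r =>
    rw [AlgHom.commutes, AlgEquiv.commutes, Algebra.commutes]
  | grade1 x =>
    rcases x with j | a
    · change D * F.act t (F.idem j) = F.idem j * D
      rw [act_idem, sum_mul_idem, idem_mul_sum]
    · change D * F.act t (F.toAlg (F.arr a)) = F.toAlg (F.arr a) * D
      have htail : F.idem (F.tail a) * F.toAlg (F.arr a) = F.toAlg (F.arr a) := by
        rw [idem, ← map_mul, vtx, arr, ← map_mul, F.toPathAlgebra_rel (.tail a)]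
      have hhead : F.toAlg (F.arr a) * F.idem (F.head a) = F.toAlg (F.arr a) := by
        rw [idem, ← map_mul, vtx, arr, ← map_mul, F.toPathAlgebra_rel (.head a)]
      rw [act_toAlg, rescale_arr, map_smul, mul_smul_comm]
      conv_lhs => rw [← htail, ← mul_assoc, sum_mul_idem, smul_mul_assoc, htail, smul_smul]
      conv_rhs => rw [← hhead, mul_assoc, idem_mul_sum, mul_smul_comm, hhead]
      rw [← hσ, Units.val_mul]
  | mul x y hx hy =>
    rw [map_mul, map_mul, ← mul_assoc, hx, mul_assoc, hy, mul_assoc]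
  | add x y hx hy =>
    rw [map_add, map_add, mul_add, hx, hy, add_mul]

/-- Conjugation by a diagonal element is scalar on each corner: D acts as σ(i') on the left and as
σ(j) on the right. -/
theorem LoopTrivial.exists_actCorner_eq_smul {i : F.Tile} {t : F.relationTorus}
    (ht : F.LoopTrivial i t.1) (i' j : F.Tile) :
    ∃ c : ℂˣ, ∀ x, F.actCorner t i' j x = (c : ℂ) • x := by
  obtain ⟨σ, hσ⟩ := ht.exists_potential
  refine ⟨(σ i')⁻¹ * σ j, fun x => Subtype.ext ?_⟩
  change F.act t x.1 = (((σ i')⁻¹ * σ j : ℂˣ) : ℂ) • x.1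
  have h := F.sum_mul_act t hσ x.1
  have h₁ := (F.act_mem_corner t x.2).1
  rw [← h₁, ← mul_assoc, sum_mul_idem, smul_mul_assoc, h₁] at h
  conv_rhs at h => rw [← x.2.2, mul_assoc, idem_mul_sum, mul_smul_comm, x.2.2]
  rw [Units.val_mul, ← smul_smul, ← h, smul_smul, ← Units.val_mul, inv_mul_cancel, Units.val_one,
    one_smul]

/-- On the kernel of any framed point the action is multiplication by a unit of `R`, and this
preserves every submodule. -/
theorem LoopTrivial.θ_eq_one {i : F.Tile} {t : F.relationTorus}
    (ht : F.LoopTrivial i t.1) : F.θ i t = 1 := by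
  funext v
  refine Iso.ext ?_
  change F.actModuli t v i = 𝟙 _
  ext R : 2
  refine ConcreteCategory.hom_ext _ _ fun (N : F.FramedPoint v i R) => ?_
  refine FramedPoint.ext (funext fun j => Module.Grassmannian.ext ?_)
  have hinv : F.LoopTrivial i (t⁻¹).1 := fun l hl => by
    have h : (l.map fun a => (t.1 a)⁻¹ * t.1 a).prod = 1 := by simp
    rwa [List.prod_map_mul, ht l hl, mul_one] at h
  obtain ⟨c, hc⟩ := hinv.exists_actCorner_eq_smul F i j
  have hcr : (F.actCorner t i j).symm.toLinearMap = (c : ℂ) • LinearMap.id := by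
    rw [actCorner_symm]
    exact LinearMap.ext hc
  ext x
  change x ∈ (grassmannianImage (M := F.corner i j) (F.actCorner t i j) (N.ker j)).toSubmodule ↔ _
  rw [mem_grassmannianImage]
  have hx : (F.actCorner t i j).symm.baseChange ℂ R _ _ x =
      algebraMap ℂ R c • x := by
    change (F.actCorner t i j).symm.toLinearMap.baseChange R x = _
    rw [hcr, LinearMap.baseChange_smul, LinearMap.baseChange_id, LinearMap.smul_apply,
      LinearMap.id_apply, algebraMap_smul]
  rw [hx]
  exact Submodule.smul_mem_iff_of_isUnit _ (c.isUnit.map (algebraMap ℂ R))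

/-! ### Detecting loop weights on a moduli space -/

section TrivialPoint
open Classical

/-- The functional on `e_i A_F e_j` sending each path to `1`. -/
def pathFunctional (i j : F.Tile) : F.corner i j →ₗ[ℂ] ℂ :=
  Matrix.entryLinearMap ℂ ℂ i j ∘ₗ F.algRep.toLinearMap ∘ₗ (F.corner i j).subtype

theorem pathFunctional_cls {i j : F.Tile} {l : List E} (h : F.IsPath i j l) :
    F.pathFunctional i j ⟨F.cls i l, F.cls_mem_corner h⟩ = 1 := by
  change F.algRep (F.cls i l) i j = 1
  rw [F.algRep_cls h, Matrix.single_apply_same]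

/-- Elements of corners have images supported in a single matrix entry, so entries multiply. Hence
the kernels of these functionals form a right submodule. -/
theorem pathFunctional_rmul {i j k : F.Tile} (x : F.corner i j) (a : F.corner j k) :
    F.pathFunctional i k (F.rmul i a x) = F.pathFunctional i j x * F.algRep a.1 j k := by
  change F.algRep (x.1 * a.1) i k = F.algRep x.1 i j * F.algRep a.1 j k
  rw [map_mul, F.algRep_corner x.2, F.algRep_corner a.2, Matrix.single_mul_single_same,
    Matrix.single_apply_same, Matrix.single_apply_same, Matrix.single_apply_same]

/-- `pathFunctional` on `ℂ ⊗ e_i A_F e_j`. -/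
def tensorPathFunctional (i j : F.Tile) : ℂ ⊗[ℂ] F.corner i j →ₗ[ℂ] ℂ :=
  F.pathFunctional i j ∘ₗ (TensorProduct.lid ℂ (F.corner i j)).toLinearMap

theorem tensorPathFunctional_surjective (i j : F.Tile) :
    Function.Surjective (F.tensorPathFunctional i j) := by
  obtain ⟨l, hl⟩ := F.exists_isPath i j
  intro c
  refine ⟨c ⊗ₜ ⟨F.cls i l, F.cls_mem_corner hl⟩, ?_⟩
  rw [tensorPathFunctional, LinearMap.comp_apply, LinearEquiv.coe_coe, TensorProduct.lid_tmul,
    map_smul, F.pathFunctional_cls hl, smul_eq_mul, mul_one]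

/-- The module of dimension vector `(1, …, 1)` on which all arrows act as identities. -/
def trivialPoint (i : F.Tile) : F.FramedPoint (fun _ => 1) i ℂ where
  ker j :=
    letI e := (F.tensorPathFunctional i j).quotKerEquivOfSurjective
      (F.tensorPathFunctional_surjective i j)
    { toSubmodule := LinearMap.ker (F.tensorPathFunctional i j)
      finite_quotient := Module.Finite.equiv e.symm
      projective_quotient := Module.Projective.of_equiv e.symm
      rankAtStalk_eq := fun p => by
        rw [Module.rankAtStalk_eq_of_equiv e, Module.rankAtStalk_self]; rfl }
  rmul_mem j k a x hx := by
    have key : F.tensorPathFunctional i k ∘ₗ (F.rmul i a).baseChange ℂ =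
        F.algRep a.1 j k • F.tensorPathFunctional i j := by
      ext y
      simp [tensorPathFunctional, pathFunctional_rmul, mul_comm]
    change F.tensorPathFunctional i j x = 0 at hx
    have := LinearMap.congr_fun key x
    rw [LinearMap.smul_apply, hx, smul_zero] at this
    exact this

theorem mem_trivialPoint (i j : F.Tile) (x : ℂ ⊗[ℂ] F.corner i j) :
    x ∈ ((F.trivialPoint i).ker j).toSubmodule ↔ F.tensorPathFunctional i j x = 0 := Iff.rfl

theorem loopTrivial_of_θ_eq_one {i : F.Tile} {t : F.relationTorus} (ht : F.θ i t = 1) :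
    F.LoopTrivial i t.1 := by
  intro l hl
  -- The inverse is used because membership in the image under `t⁻¹` is tested by applying `t`.
  have h₁ : F.actModuli t⁻¹ (fun _ => 1) i = 𝟙 _ := by
    have : F.θ i t⁻¹ = 1 := by rw [map_inv, ht, inv_one]
    exact congrArg Iso.hom (congrFun this _)
  have h₂ : F.actPoint t⁻¹ (F.trivialPoint i) = F.trivialPoint i :=
    congrArg (fun f => f.app (CommAlgCat.of ℂ ℂ) (F.trivialPoint i)) h₁
  have h₃ : grassmannianImage (M := F.corner i i) (F.actCorner t⁻¹ i i)
      ((F.trivialPoint i).ker i) = (F.trivialPoint i).ker i :=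
    congrFun (congrArg FramedPoint.ker h₂) i
  have hnil : F.IsPath i i [] := rfl
  let x : F.corner i i := ⟨F.cls i l, F.cls_mem_corner hl⟩
  let y : F.corner i i := ⟨F.cls i [], F.cls_mem_corner hnil⟩
  have hx : F.actCorner t i i x = ((l.map t.1).prod : ℂ) • x := Subtype.ext (F.act_cls t i l)
  have hy : F.actCorner t i i y = y := Subtype.ext ((F.act_cls t i []).trans (by simp [y]))
  have hφ (z : F.corner i i) : F.tensorPathFunctional i i ((1 : ℂ) ⊗ₜ z) =
      F.pathFunctional i i z := by
    rw [tensorPathFunctional, LinearMap.comp_apply, LinearEquiv.coe_coe, TensorProduct.lid_tmul,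
      one_smul]
  -- `x - y` is the loop minus the constant path. It lies in the kernel, and `t` sends it to
  -- (weight)·`x - y`, on which the functional takes the value weight − 1.
  have h₄ : (1 : ℂ) ⊗ₜ[ℂ] (x - y) ∈ ((F.trivialPoint i).ker i).toSubmodule := by
    rw [mem_trivialPoint, hφ, map_sub, F.pathFunctional_cls hl, F.pathFunctional_cls hnil, sub_self]
  rw [← h₃, mem_grassmannianImage, mem_trivialPoint] at h₄
  have h₅ : F.tensorPathFunctional i i ((1 : ℂ) ⊗ₜ (F.actCorner t i i (x - y))) = 0 := h₄
  rw [map_sub, hx, hy, hφ, map_sub, map_smul, F.pathFunctional_cls hl, F.pathFunctional_cls hnil,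
    smul_eq_mul, mul_one, sub_eq_zero] at h₅
  exact Units.ext h₅

end TrivialPoint

theorem θ_eq_one_iff {i : F.Tile} {t : F.relationTorus} :
    F.θ i t = 1 ↔ F.LoopTrivial i t.1 :=
  ⟨F.loopTrivial_of_θ_eq_one, fun h => h.θ_eq_one⟩

/-! ### The homology of the surface is free of rank `2 * g` -/

theorem blackEnd_black (e : E) : F.blackEnd (F.black e) = F.blackEnd e :=
  Quotient.sound ⟨-1, by simp⟩

theorem whiteEnd_white (e : E) : F.whiteEnd (F.white e) = F.whiteEnd e :=
  Quotient.sound ⟨-1, by simp⟩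

theorem d₂_apply (y : F.BlackVertex ⊕ F.WhiteVertex →₀ ℤ) (e : E) :
    F.d₂ y e = y (Sum.inl (F.blackEnd e)) - y (Sum.inr (F.whiteEnd e)) := by
  classical
  suffices h : Finsupp.lapply e ∘ₗ F.d₂ = Finsupp.lapply (R := ℤ) (Sum.inl (F.blackEnd e)) -
      Finsupp.lapply (Sum.inr (F.whiteEnd e)) from LinearMap.congr_fun h y
  ext v
  rcases v with v | v <;>
    simp [d₂, Finsupp.single_apply, eq_comm]

/-- The fundamental 2-cycle of the surface. -/
def fundamentalCycle : F.BlackVertex ⊕ F.WhiteVertex →₀ ℤ :=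
  Finsupp.equivFunOnFinite.symm fun _ => 1

theorem fundamentalCycle_apply (v : F.BlackVertex ⊕ F.WhiteVertex) : F.fundamentalCycle v = 1 := rfl

theorem d₂_fundamentalCycle : F.d₂ F.fundamentalCycle = 0 := by
  ext e
  simp [d₂_apply, fundamentalCycle_apply]

/-- A 2-chain whose boundary is divisible by `n` is constant modulo `n`. -/
theorem exists_dvd_sub_of_dvd_d₂ {n : ℤ} {y : F.BlackVertex ⊕ F.WhiteVertex →₀ ℤ}
    (h : ∀ e, n ∣ F.d₂ y e) : ∃ c, ∀ v, n ∣ y v - c := by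
  simp only [d₂_apply] at h
  obtain ⟨e₀⟩ := F.nonempty
  -- The edges `e` and `white e` share their white endpoint, so subtracting their hypotheses
  -- compares their black endpoints modulo `n`.
  have hb : ∀ e, n ∣ y (Sum.inl (F.blackEnd e)) - y (Sum.inl (F.blackEnd e₀)) := by
    refine F.forall_of_step (fun e he => ?_) (fun e he => ?_) (e₀ := e₀) (by simp)
    · rwa [blackEnd_black]
    · have h₁ := h (F.white e)
      have h₂ := h e
      rw [whiteEnd_white] at h₁
      have := (h₁.sub h₂).add he
      rwa [sub_sub_sub_cancel_right, sub_add_sub_cancel] at this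
  refine ⟨y (Sum.inl (F.blackEnd e₀)), ?_⟩
  rintro (v | v)
  · obtain ⟨e, rfl⟩ : ∃ e, F.blackEnd e = v := Quotient.exists_rep v
    exact hb e
  · obtain ⟨e, rfl⟩ : ∃ e, F.whiteEnd e = v := Quotient.exists_rep v
    have := (hb e).sub (h e)
    rwa [sub_sub_sub_cancel_left] at this

/-- Divisibility by 0 is vanishing, so the case `n = 0` of `exists_dvd_sub_of_dvd_d₂` says that
2-cycles are constant. -/
theorem ker_d₂ : LinearMap.ker F.d₂ =
    LinearMap.range (LinearMap.toSpanSingleton ℤ _ F.fundamentalCycle) := by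
  ext y
  constructor
  · intro hy
    rw [LinearMap.mem_ker] at hy
    obtain ⟨c, hc⟩ := F.exists_dvd_sub_of_dvd_d₂ (n := 0) (y := y) (by simp [hy])
    refine ⟨c, Finsupp.ext fun v => ?_⟩
    have := hc v
    rw [zero_dvd_iff, sub_eq_zero] at this
    simp [this, fundamentalCycle_apply]
  · rintro ⟨c, rfl⟩
    rw [LinearMap.mem_ker, LinearMap.toSpanSingleton_apply, map_smul, d₂_fundamentalCycle,
      smul_zero]

theorem finrank_ker_d₂ : Module.finrank ℤ (LinearMap.ker F.d₂) = 1 := by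
  rw [ker_d₂, LinearMap.finrank_range_of_inj, Module.finrank_self]
  intro a b hab
  obtain ⟨e⟩ := F.nonempty
  simpa [fundamentalCycle_apply] using DFunLike.congr_fun hab (Sum.inl (F.blackEnd e))

/-- The 2-boundaries form a saturated subgroup of the 1-chains. -/
theorem mem_range_d₂_of_smul_mem {n : ℤ} (hn : n ≠ 0) {x : E →₀ ℤ}
    (h : n • x ∈ LinearMap.range F.d₂) : x ∈ LinearMap.range F.d₂ := by
  obtain ⟨y, hy⟩ := h
  -- Subtracting `c` times the fundamental cycle leaves the boundary unchanged and makes the 2-chain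
  -- divisible by `n`; the quotient `y'` bounds `x`.
  obtain ⟨c, hc⟩ := F.exists_dvd_sub_of_dvd_d₂ (n := n) (y := y) fun e => ⟨x e, by simp [hy]⟩
  choose y' hy' using hc
  refine ⟨Finsupp.equivFunOnFinite.symm y', Finsupp.ext fun e => mul_left_cancel₀ hn ?_⟩
  have := DFunLike.congr_fun hy e
  rw [d₂_apply, Finsupp.smul_apply, smul_eq_mul] at this
  rw [← this, d₂_apply, mul_sub]
  change n * y' _ - n * y' _ = _
  rw [← hy', ← hy', sub_sub_sub_cancel_right]

theorem mem_range_boundary_iff (z : LinearMap.ker F.d₁) :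
    z ∈ LinearMap.range F.boundary ↔ z.1 ∈ LinearMap.range F.d₂ := by
  constructor
  · rintro ⟨y, rfl⟩
    exact ⟨y, rfl⟩
  · rintro ⟨y, hy⟩
    exact ⟨y, Subtype.ext hy⟩

instance isTorsionFree_quotient_range_d₂ :
    Module.IsTorsionFree ℤ ((E →₀ ℤ) ⧸ LinearMap.range F.d₂) := by
  refine Module.isTorsionFree_iff_smul_eq_zero.2 fun n x hx => or_iff_not_imp_left.2 fun hn => ?_
  obtain ⟨x, rfl⟩ := Submodule.Quotient.mk_surjective _ x
  rw [← Submodule.Quotient.mk_smul, Submodule.Quotient.mk_eq_zero] at hx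
  rw [Submodule.Quotient.mk_eq_zero]
  exact F.mem_range_d₂_of_smul_mem hn hx

instance isTorsionFree_H₁ : Module.IsTorsionFree ℤ F.H₁ := by
  refine Module.isTorsionFree_iff_smul_eq_zero.2 fun n x hx => or_iff_not_imp_left.2 fun hn => ?_
  obtain ⟨x, rfl⟩ := Submodule.Quotient.mk_surjective _ x
  rw [← Submodule.Quotient.mk_smul, Submodule.Quotient.mk_eq_zero, mem_range_boundary_iff] at hx
  rw [Submodule.Quotient.mk_eq_zero, mem_range_boundary_iff]
  exact F.mem_range_d₂_of_smul_mem hn hx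

theorem finrank_range_add_finrank_ker_int {M N : Type u} [AddCommGroup M] [AddCommGroup N]
    [Module.Finite ℤ M] (f : M →ₗ[ℤ] N) :
    Module.finrank ℤ (LinearMap.range f) + Module.finrank ℤ (LinearMap.ker f) =
      Module.finrank ℤ M := by
  rw [← f.quotKerEquivRange.finrank_eq, Submodule.finrank_quotient_add_finrank]

/-- The augmentation map on 0-chains. -/
def augmentation : (F.Tile →₀ ℤ) →ₗ[ℤ] ℤ := Finsupp.linearCombination ℤ fun _ => 1

/-- Strong connectedness joins any tile `j` to a base tile `i` by a path, whose boundary is the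
difference j − i. -/
theorem range_d₁ : LinearMap.range F.d₁ = LinearMap.ker F.augmentation := by
  apply le_antisymm
  · rw [LinearMap.range_le_ker_iff]
    ext a
    simp [d₁, augmentation]
  · intro x hx
    obtain ⟨e⟩ := F.nonempty
    set i := F.tail e
    have key : ∀ x : F.Tile →₀ ℤ, x - F.augmentation x • Finsupp.single i 1 ∈
        LinearMap.range F.d₁ := by
      intro x
      induction x using Finsupp.induction_linear with
      | zero => simp
      | add x y hx hy =>
        convert add_mem hx hy using 1
        rw [map_add, add_smul]
        abel
      | single j n =>
        obtain ⟨l, hl⟩ := F.exists_isPath i j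
        refine ⟨n • chain l, ?_⟩
        rw [map_smul, F.d₁_chain hl, smul_sub]
        simp [augmentation]
    have := key x
    rwa [LinearMap.mem_ker.1 hx, zero_smul, sub_zero] at this

theorem finrank_range_d₁ :
    Module.finrank ℤ (LinearMap.range F.d₁) + 1 = Nat.card F.Tile := by
  have hsurj : LinearMap.range F.augmentation = ⊤ := by
    obtain ⟨e⟩ := F.nonempty
    exact LinearMap.range_eq_top.2 fun n =>
      ⟨Finsupp.single (F.tail e) n, by simp [augmentation]⟩
  have h := Submodule.finrank_quotient_add_finrank (LinearMap.ker F.augmentation)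
  rw [F.augmentation.quotKerEquivRange.finrank_eq, hsurj, finrank_top, Module.finrank_self,
    Module.finrank_finsupp_self, ← range_d₁] at h
  rw [Nat.card_eq_fintype_card, ← h, add_comm]

/-- Rank count: im d₁ has rank (tiles − 1) and ker d₂ has rank 1, so the rank of H₁ is 2 minus the
Euler characteristic. -/
theorem finrank_H₁ {g : ℕ} (hg : F.HasGenus g) : Module.finrank ℤ F.H₁ = 2 * g := by
  have h₁ := F.finrank_range_d₁
  have h₂ := finrank_range_add_finrank_ker_int F.d₁
  have h₃ := finrank_range_add_finrank_ker_int F.d₂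
  have h₄ : Module.finrank ℤ F.H₁ + Module.finrank ℤ (LinearMap.range F.boundary) =
      Module.finrank ℤ (LinearMap.ker F.d₁) := Submodule.finrank_quotient_add_finrank _
  have h₅ : Module.finrank ℤ (LinearMap.range F.boundary) =
      Module.finrank ℤ (LinearMap.range F.d₂) := by
    have hk : LinearMap.ker F.boundary = LinearMap.ker F.d₂ := LinearMap.ker_codRestrict _ _ _
    have := finrank_range_add_finrank_ker_int F.boundary
    rw [hk] at this
    omega
  rw [finrank_ker_d₂, Module.finrank_finsupp_self, Fintype.card_sum] at h₃
  rw [Module.finrank_finsupp_self] at h₂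
  rw [HasGenus, Nat.card_eq_fintype_card, Nat.card_eq_fintype_card,
    Nat.card_eq_fintype_card] at hg
  omega

/-- There is a basis of `H₁` whose coordinate functions are restrictions of linear forms on all
1-chains. -/
theorem exists_basis_H₁ {g : ℕ} (hg : F.HasGenus g) :
    ∃ (B : Module.Basis (Fin (2 * g)) ℤ F.H₁) (r : (E →₀ ℤ) →ₗ[ℤ] Fin (2 * g) → ℤ),
      ∀ z : LinearMap.ker F.d₁, r z = B.equivFun (Submodule.Quotient.mk z) := by
  have hfree : Module.Free ℤ F.H₁ := Module.free_of_finite_type_torsion_free'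
  let B : Module.Basis (Fin (2 * g)) ℤ F.H₁ := Module.finBasisOfFinrankEq ℤ F.H₁ (F.finrank_H₁ hg)
  have hr : Module.Projective ℤ (LinearMap.range F.d₁) := inferInstance
  -- The image of `d₁` is projective, so `d₁` splits over it. This yields the projection `π` of
  -- 1-chains onto 1-cycles, through which the coordinates on H₁ extend.
  obtain ⟨s, hs⟩ := F.d₁.rangeRestrict.exists_rightInverse_of_surjective F.d₁.range_rangeRestrict
  let π : (E →₀ ℤ) →ₗ[ℤ] LinearMap.ker F.d₁ :=
    (LinearMap.id - s ∘ₗ F.d₁.rangeRestrict).codRestrict _ fun x => by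
      have := congrArg Subtype.val (LinearMap.congr_fun hs (F.d₁.rangeRestrict x))
      change F.d₁ (s _) = F.d₁ x at this
      rw [LinearMap.mem_ker, LinearMap.sub_apply, map_sub, LinearMap.comp_apply, this,
        LinearMap.id_apply, sub_self]
  refine ⟨B, B.equivFun.toLinearMap ∘ₗ Submodule.mkQ _ ∘ₗ π, fun z => ?_⟩
  have hπ : π z = z := Subtype.ext <| by
    change z.1 - s (F.d₁.rangeRestrict z.1) = z.1
    have : F.d₁.rangeRestrict z.1 = 0 := Subtype.ext z.2
    rw [this, map_zero, sub_zero]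
  rw [LinearMap.comp_apply, LinearMap.comp_apply, hπ]
  rfl

/-! ### Monomial parametrizations -/

/-- The rescaling with parameter `s` in the family of rescalings given by the Laurent monomials with
exponents `r`. -/
def monomialRescaling {n : ℕ} (r : (E →₀ ℤ) →ₗ[ℤ] Fin n → ℤ) (s : Fin n → ℂˣ) : E → ℂˣ :=
  fun e => ∏ k, s k ^ r (Finsupp.single e 1) k

omit [Fintype E] in
theorem weight_monomialRescaling {n : ℕ} (r : (E →₀ ℤ) →ₗ[ℤ] Fin n → ℤ) (s : Fin n → ℂˣ)
    (x : E →₀ ℤ) : weight (monomialRescaling r s) x = ∑ k, r x k • Additive.ofMul (s k) := by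
  have : weight (monomialRescaling r s) =
      Fintype.linearCombination ℤ (fun k => Additive.ofMul (s k)) ∘ₗ r := by
    refine weight_eq_of_single fun e => ?_
    rw [LinearMap.comp_apply, Fintype.linearCombination_apply, monomialRescaling, ofMul_prod]
    rfl
  rw [this, LinearMap.comp_apply, Fintype.linearCombination_apply]

/-- The cocycles are Hom(C₁/im d₂, ℂ*). The quotient is torsion-free, hence free, and the values on
a basis of it are free parameters. -/
theorem isSubtorus_cocycles : IsSubtorus F.cocycles := by
  have hfree : Module.Free ℤ ((E →₀ ℤ) ⧸ LinearMap.range F.d₂) :=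
    Module.free_of_finite_type_torsion_free'
  let c := Module.finBasis ℤ ((E →₀ ℤ) ⧸ LinearMap.range F.d₂)
  let r := c.equivFun.toLinearMap ∘ₗ (LinearMap.range F.d₂).mkQ
  refine ⟨_, fun e => r (Finsupp.single e 1), Set.Subset.antisymm (fun t ht => ?_) ?_⟩
  · let h := (LinearMap.range F.d₂).liftQ (weight t) (by
      rintro _ ⟨y, rfl⟩
      exact ht y)
    refine ⟨fun k => (h (c k)).toMul, funext fun e => Additive.ofMul.injective ?_⟩
    have := congrArg h (c.sum_equivFun (Submodule.Quotient.mk (Finsupp.single e 1)))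
    rw [map_sum] at this
    simp_rw [map_smul] at this
    rw [ofMul_prod]
    exact this.trans (weight_single t e)
  · rintro _ ⟨s, rfl⟩ y
    change weight (monomialRescaling r s) _ = 0
    have : r (F.d₂ y) = 0 := by
      have hy : (LinearMap.range F.d₂).mkQ (F.d₂ y) = 0 :=
        (Submodule.Quotient.mk_eq_zero _).2 ⟨y, rfl⟩
      rw [LinearMap.comp_apply, hy, map_zero]
    rw [weight_monomialRescaling, this]
    simp

/-! ### Coordinates and characters of T_W -/

theorem mem_TW'_iff {i : F.Tile} {t : F.relationTorus} : t ∈ F.TW' i ↔ t.1 ∈ F.cocycles := by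
  have : largestSubtorus F.cocycles = F.cocycles :=
    le_antisymm (sSup_le fun _ h => h.2) (le_sSup ⟨F.isSubtorus_cocycles, le_rfl⟩)
  rw [TW', map_loopStabilizer, this]
  rfl

/-- The weights of an element of `T'_W` on homology classes. -/
def homologyWeight {i : F.Tile} (t : F.TW' i) : F.H₁ →ₗ[ℤ] Additive ℂˣ :=
  Submodule.liftQ _ (weight t.1.1 ∘ₗ (LinearMap.ker F.d₁).subtype) (by
    rintro _ ⟨y, rfl⟩
    exact F.mem_TW'_iff.1 t.2 y)

theorem homologyWeight_mk {i : F.Tile} (t : F.TW' i) (z : LinearMap.ker F.d₁) :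
    F.homologyWeight t (Submodule.Quotient.mk z) = weight t.1.1 z.1 := rfl

theorem homologyWeight_loopClass {i : F.Tile} (t : F.TW' i) {l : List E} (hl : F.IsPath i i l) :
    F.homologyWeight t (F.loopClass hl) = Additive.ofMul (l.map t.1.1).prod :=
  weight_chain _ _

theorem toTW_eq_one_iff {i : F.Tile} (t : F.TW' i) :
    F.toTW i t = 1 ↔ F.homologyWeight t = 0 := by
  have : F.toTW i t = 1 ↔ F.θ i t.1 = 1 := Subtype.ext_iff
  rw [this, θ_eq_one_iff]
  constructor
  · intro h
    refine LinearMap.ext fun x => ?_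
    obtain ⟨z, rfl⟩ := Submodule.Quotient.mk_surjective _ x
    exact h.weight_eq_zero F z.2
  · intro h l hl
    have := F.homologyWeight_loopClass t hl
    rw [h] at this
    exact this.symm

section Coordinates

variable {n : ℕ} (B : Module.Basis (Fin n) ℤ F.H₁)

/-- The weights of an element of `T'_W` on the elements of a basis of `H₁`. -/
def basisWeights (i : F.Tile) : F.TW' i →* (Fin n → ℂˣ) where
  toFun t k := (F.homologyWeight t (B k)).toMul
  map_one' := funext fun k => by
    obtain ⟨z, hz⟩ := Submodule.Quotient.mk_surjective _ (B k)
    rw [← hz, homologyWeight_mk]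
    simp [weight_apply]
  map_mul' s t := funext fun k => by
    obtain ⟨z, hz⟩ := Submodule.Quotient.mk_surjective _ (B k)
    rw [Pi.mul_apply, ← hz, homologyWeight_mk, homologyWeight_mk, homologyWeight_mk, ← toMul_add]
    exact congrArg _ (weight_mul s.1.1 t.1.1 z.1)

theorem homologyWeight_eq_prod {i : F.Tile} (t : F.TW' i) (x : F.H₁) :
    F.homologyWeight t x = Additive.ofMul (∏ k, F.basisWeights B i t k ^ B.equivFun x k) := by
  rw [ofMul_prod]
  conv_lhs => rw [← B.sum_equivFun x, map_sum]
  simp_rw [map_smul]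
  rfl

variable {r : (E →₀ ℤ) →ₗ[ℤ] Fin n → ℤ}
  (hr : ∀ z : LinearMap.ker F.d₁, r z = B.equivFun (Submodule.Quotient.mk z))

include hr in
theorem monomialRescaling_mem_cocycles (s : Fin n → ℂˣ) :
    monomialRescaling r s ∈ F.cocycles := by
  intro y
  have h := hr (F.boundary y)
  rw [(Submodule.Quotient.mk_eq_zero _).2 (LinearMap.mem_range_self _ y), map_zero] at h
  change r (F.d₂ y) = 0 at h
  rw [weight_monomialRescaling, h]
  simp

/-- A section of `basisWeights` given by Laurent monomials. -/
def basisSection (i : F.Tile) (s : Fin n → ℂˣ) : F.TW' i :=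
  ⟨⟨monomialRescaling r s,
    F.mem_relationTorus_of_mem_cocycles (F.monomialRescaling_mem_cocycles B hr s)⟩,
    F.mem_TW'_iff.2 (F.monomialRescaling_mem_cocycles B hr s)⟩

theorem basisWeights_basisSection (i : F.Tile) (s : Fin n → ℂˣ) :
    F.basisWeights B i (F.basisSection B hr i s) = s := by
  funext k
  obtain ⟨z, hz⟩ := Submodule.Quotient.mk_surjective _ (B k)
  change (F.homologyWeight _ (B k)).toMul = s k
  rw [← hz, homologyWeight_mk]
  change (weight (monomialRescaling r s) z.1).toMul = s k
  rw [weight_monomialRescaling, hr, hz, Finset.sum_eq_single k] <;>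
    simp +contextual [eq_comm]

theorem toTW_surjective (i : F.Tile) : Function.Surjective (F.toTW i) :=
  (F.θ i).subgroupMap_surjective _

include hr in
-- `toTW` and `basisWeights` are surjections from T'_W with the same kernel, the elements of trivial
-- weight on H₁, so their targets are identified.
theorem exists_torusEquiv (i : F.Tile) :
    ∃ ψ : F.TW i ≃* (Fin n → ℂˣ), ∀ t, ψ (F.toTW i t) = F.basisWeights B i t := by
  have hker : (F.toTW i).ker = (F.basisWeights B i).ker := by
    ext t
    rw [MonoidHom.mem_ker, MonoidHom.mem_ker, toTW_eq_one_iff]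
    constructor
    · intro h
      funext k
      exact congrArg Additive.toMul (LinearMap.congr_fun h (B k))
    · intro h
      refine LinearMap.ext fun x => ?_
      rw [F.homologyWeight_eq_prod B, h]
      simp
  let e₁ := QuotientGroup.quotientKerEquivOfSurjective (F.toTW i) (F.toTW_surjective i)
  let e₂ := QuotientGroup.quotientKerEquivOfSurjective (F.basisWeights B i)
    fun s => ⟨_, F.basisWeights_basisSection B hr i s⟩
  refine ⟨(e₁.symm.trans (QuotientGroup.quotientMulEquivOfEq hker)).trans e₂, fun t => ?_⟩
  have h : e₁.symm (F.toTW i t) = QuotientGroup.mk t := e₁.symm_apply_eq.2 rfl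
  rw [MulEquiv.trans_apply, MulEquiv.trans_apply, h]
  rfl

include hr in
theorem isCharacter_iff {i : F.Tile} {ψ : F.TW i ≃* (Fin n → ℂˣ)}
    (hψ : ∀ t, ψ (F.toTW i t) = F.basisWeights B i t) (χ : F.TW i →* ℂˣ) :
    F.IsCharacter i χ ↔ ∃ m : Fin n → ℤ, ∀ x, χ x = ∏ k, ψ x k ^ m k := by
  constructor
  · rintro ⟨m, hm⟩
    -- The exponents come from pulling the monomial `m` back along the monomial section
    -- `basisSection`.
    refine ⟨r (Finsupp.equivFunOnFinite.symm m), fun x => ?_⟩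
    have hx : F.toTW i (F.basisSection B hr i (ψ x)) = x := by
      apply ψ.injective
      rw [hψ, basisWeights_basisSection]
    conv_lhs => rw [← hx, hm]
    apply Additive.ofMul.injective
    have h₁ := weight_apply (monomialRescaling r (ψ x)) (Finsupp.equivFunOnFinite.symm m)
    rw [weight_monomialRescaling] at h₁
    rw [ofMul_prod]
    exact h₁.symm
  · rintro ⟨m, hm⟩
    -- A 1-cycle representing this class supplies the exponents of a monomial on all edges.
    obtain ⟨z, hz⟩ := Submodule.Quotient.mk_surjective _ (∑ k, m k • B k)
    refine ⟨z.1, fun t => ?_⟩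
    apply Additive.ofMul.injective
    rw [← weight_apply, ← homologyWeight_mk, hz, hm, map_sum, ofMul_prod, hψ]
    simp_rw [map_smul]
    rfl

end Coordinates

/-! ### Cocharacters of T_W -/

theorem prod_pow_single {n : ℕ} (x : Fin n → ℂˣ) (k : Fin n) :
    ∏ j, x j ^ (Pi.single k 1 : Fin n → ℤ) j = x k := by
  rw [Finset.prod_eq_single k] <;> simp +contextual

theorem zpow_finsetSum {n : ℕ} (z : ℂˣ) (f : Fin n → ℤ) : z ^ ∑ k, f k = ∏ k, z ^ f k :=
  congrArg Additive.toMul (map_sum (zmultiplesHom _ (Additive.ofMul z)) f Finset.univ)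

theorem units_zpow_injective {a b : ℤ} (h : ∀ z : ℂˣ, z ^ a = z ^ b) : a = b := by
  have h2 := congrArg (fun z : ℂˣ => ‖(z : ℂ)‖) (h (Units.mk0 2 two_ne_zero))
  simp only [Units.val_zpow_eq_zpow_val, Units.val_mk0, norm_zpow, Complex.norm_ofNat] at h2
  exact zpow_right_injective₀ (by norm_num) (by norm_num) h2

/-- The cocharacter of `T_W` given by an integral functional on `H₁`. -/
def cocharacterOfFunctional {i : F.Tile} {n : ℕ} (B : Module.Basis (Fin n) ℤ F.H₁)
    (ψ : F.TW i ≃* (Fin n → ℂˣ)) (hψ : ∀ χ : F.TW i →* ℂˣ,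
      F.IsCharacter i χ ↔ ∃ m : Fin n → ℤ, ∀ x, χ x = ∏ k, ψ x k ^ m k) :
    (F.H₁ →+ ℤ) →+ Additive (F.cocharacters i) where
  toFun φ := Additive.ofMul
    ⟨ψ.symm.toMonoidHom.comp (MonoidHom.pi fun k => zpowGroupHom (φ (B k))), fun χ hχ => by
      obtain ⟨m, hm⟩ := (hψ χ).1 hχ
      refine ⟨∑ k, φ (B k) * m k, fun z => ?_⟩
      rw [hm, BraneTiling.zpow_finsetSum]
      refine Finset.prod_congr rfl fun k _ => ?_
      rw [zpow_mul]
      exact congrArg (fun x => x k ^ m k) (ψ.apply_symm_apply _)⟩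
  map_zero' := by
    apply Additive.toMul.injective
    refine Subtype.ext (MonoidHom.ext fun z => ψ.injective ?_)
    funext k
    simp
  map_add' φ φ' := by
    apply Additive.toMul.injective
    refine Subtype.ext (MonoidHom.ext fun z => ψ.injective ?_)
    funext k
    simp [zpow_add]

theorem cocharacterOfFunctional_apply {i : F.Tile} {n : ℕ} (B : Module.Basis (Fin n) ℤ F.H₁)
    (ψ : F.TW i ≃* (Fin n → ℂˣ)) (hψ : ∀ χ : F.TW i →* ℂˣ,
      F.IsCharacter i χ ↔ ∃ m : Fin n → ℤ, ∀ x, χ x = ∏ k, ψ x k ^ m k)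
    (φ : F.H₁ →+ ℤ) (z : ℂˣ) (k : Fin n) :
    ψ ((F.cocharacterOfFunctional B ψ hψ φ).toMul.1 z) k = z ^ φ (B k) :=
  congrFun (ψ.apply_symm_apply _) k

/-- The coordinates of ψ are characters, so along a cocharacter each is z ↦ z ^ m k. These integers
are arbitrary and determine the functional by its values on the basis `B`. -/
theorem cocharacterOfFunctional_bijective {i : F.Tile} {n : ℕ} (B : Module.Basis (Fin n) ℤ F.H₁)
    (ψ : F.TW i ≃* (Fin n → ℂˣ)) (hψ : ∀ χ : F.TW i →* ℂˣ,
      F.IsCharacter i χ ↔ ∃ m : Fin n → ℤ, ∀ x, χ x = ∏ k, ψ x k ^ m k) :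
    Function.Bijective (F.cocharacterOfFunctional B ψ hψ) := by
  constructor
  · intro φ φ' h
    have : φ.toIntLinearMap = φ'.toIntLinearMap := B.ext fun k => units_zpow_injective fun z => by
      have h₁ := F.cocharacterOfFunctional_apply B ψ hψ φ z k
      rw [h, cocharacterOfFunctional_apply] at h₁
      exact h₁.symm
    exact AddMonoidHom.ext fun x => LinearMap.congr_fun this x
  · intro α
    have hα : ∀ k, ∃ n : ℤ, ∀ z, ψ (α.toMul.1 z) k = z ^ n := fun k =>
      α.toMul.2 ((Pi.evalMonoidHom _ k).comp ψ.toMonoidHom)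
        ((hψ _).2 ⟨Pi.single k 1, fun x => (prod_pow_single _ k).symm⟩)
    choose m hm using hα
    refine ⟨(B.constr ℤ m).toAddMonoidHom, ?_⟩
    apply Additive.toMul.injective
    refine Subtype.ext (MonoidHom.ext fun z => ψ.injective (funext fun k => ?_))
    rw [cocharacterOfFunctional_apply, hm]
    congr 1
    exact B.constr_basis ℤ m k
end BraneTiling

end

theorem lemma5p1 {E : Type u} [Fintype E] (F : BraneTiling E) (g : ℕ) (hg : F.HasGenus g)
    (i : F.Tile) :
    -- `T_W` is a torus of dimension `2g`
    F.IsTorusOfDim i (2 * g) ∧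
    -- its cocharacter lattice is the dual of `H₁(M_g, ℤ)`: a cocharacter `α` corresponds to the
    -- functional whose value on the class of an `i`-loop is the weight of `α` on this loop
    (∃ Φ : Additive (F.cocharacters i) ≃+ (F.H₁ →+ ℤ),
      ∀ (α : F.cocharacters i) (z : ℂˣ) (t : F.TW' i), F.toTW i t = α.1 z →
        ∀ (l : List E) (hl : F.IsPath i i l),
          F.act t (F.cls i l) =
            ((z ^ Φ (Additive.ofMul α) (F.loopClass hl) : ℂˣ) : ℂ) • F.cls i l) ∧
    -- and the dual of `H₁(M_g, ℤ)` is free abelian of rank `2g`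
    Nonempty ((F.H₁ →+ ℤ) ≃+ (Fin (2 * g) → ℤ)) := by
  obtain ⟨B, r, hr⟩ := F.exists_basis_H₁ hg
  obtain ⟨ψ, hψ⟩ := F.exists_torusEquiv B hr i
  have hχ := F.isCharacter_iff B hr hψ
  refine ⟨⟨ψ, hχ⟩, ⟨(AddEquiv.ofBijective _
    (F.cocharacterOfFunctional_bijective B ψ hχ)).symm, fun α z t ht l hl => ?_⟩,
    ⟨((addMonoidHomLequivInt ℤ).toAddEquiv.trans (B.constr ℤ).symm.toAddEquiv)⟩⟩
  obtain ⟨φ, hφ⟩ := (F.cocharacterOfFunctional_bijective B ψ hχ).2 (Additive.ofMul α)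
  have hΦ : (AddEquiv.ofBijective _ (F.cocharacterOfFunctional_bijective B ψ hχ)).symm
      (Additive.ofMul α) = φ := (AddEquiv.symm_apply_eq _).2 hφ.symm
  rw [hΦ, F.act_cls]
  congr 2
  apply Additive.ofMul.injective
  have hα : ∀ k, F.basisWeights B i t k = z ^ φ (B k) := fun k => by
    rw [← hψ, ht, ← F.cocharacterOfFunctional_apply B ψ hχ, hφ]
    rfl
  -- The weight of `t` on the loop depends only on its homology class; expanding that class in `B`
  -- reduces the claim to the basis weights z ^ φ(B k).
  rw [← F.homologyWeight_loopClass t hl, F.homologyWeight_eq_prod B]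
  conv_rhs => rw [← B.sum_equivFun (F.loopClass hl), map_sum, BraneTiling.zpow_finsetSum]
  refine congrArg _ (Finset.prod_congr rfl fun k _ => ?_)
  rw [hα, map_zsmul, smul_eq_mul, zpow_mul']
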